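/- Let $X,Y,Z$ be real Banach spaces, $\mathcal U\subset Z$, $F:\mathbb R^n\times X\times\mathcal U\to Y$, $f:\mathbb R^n\times X\to\mathbb R^{m_1}$, $g:\mathbb R^n\times X\to\mathbb R^{m_2}$, and consider the control system $$F(\xi,x,u)=0,\quad u\in\mathcal U,\quad f(\xi,x)\le 0,\quad g(\xi,x)=0 \qquad (1)$$ (inequalities between vectors are coordinatewise). Let $(\hat\xi,\hat x,\hat u)$ be an admissible point: it satisfies all relations of (1) and $\hat u\in\operatorname{int}\mathcal U$. A hat over $F,f,g$ or their (partial) Fréchet derivatives denotes the value at this point. Assume: (a) $F$ has a continuous second derivative in a neighbourhood of $(\hat\xi,\hat x,\hat u)$, $f$ and $g$ have continuous second derivatives in a neighbourhood of $(\hat\xi,\hat x)$, and $\hat F_x:X\to Y$ is invertible (with continuous inverse). There is an open neighbourhood $V$ of $(\hat\xi,\hat x)$ such that: (b) $F$ is continuous on $V\times\mathcal U$, and for each $u\in\mathcal U$ the partial derivative $F_x(\cdot,\cdot,u)$ exists and is continuous on $V$; (c) (mixes of controls) put $\Sigma^k=\{\alpha\in\mathbb R^k:\alpha_i\ge0,\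 \sum_{i=1}^k\alpha_i<1\}$ and $\alpha_0=1-\sum_{i=1}^k\alpha_i$. For all $k\ge1$ and $\varepsilon>0$ there is a mapping $M_\varepsilon:\Sigma^k\times\mathcal U^{k+1}\to\mathcal U$, with $\alpha\mapsto M_\varepsilon(\alpha,\bar u)$ continuous on $\Sigma^k$ for each $\bar u=(u_0,\dots,u_k)\in\mathcal U^{k+1}$, such that every point of $V\times\mathcal U^{k+1}$ has a neighbourhood in which, for all $(\xi,x,\bar u)$ in it and all $\alpha\in\Sigma^k$, $$\Bigl\|F(\xi,x,M_\varepsilon(\alpha,\bar u))-\sum_{i=0}^k\alpha_iF(\xi,x,u_i)\Bigr\|<\varepsilon,\qquad \Bigl\|F_x(\xi,x,M_\varepsilon(\alpha,\bar u))-\sum_{i=0}^k\alpha_iF_x(\xi,x,u_i)\Bigr\|<\varepsilon .$$ Let $K$ be the set of $q=(\zeta,h,v)\in\mathbb R^n\times X\times Z$ with $\hat F'q=0$, $\hat f'[\zeta,h]\le0$, $\hat g'[\zeta,h]=0$. For $q\in K$ let $\Lambda(q)$ be the set of triples $(y^*,\lambda_1,\lambda_2)\in Y^*\times(\mathbb R^{m_1})^*\times(\mathbb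 R^{m_2})^*$ with $\lambda_1\ge0$ and $|\lambda_1|+|\lambda_2|\ne0$ such that $$\hat F_\xi^*y^*+\hat f_\xi^*\lambda_1+\hat g_\xi^*\lambda_2=0,\qquad \hat F_x^*y^*+\hat f_x^*\lambda_1+\hat g_x^*\lambda_2=0,$$ $$\min_{u\in\mathcal U}\langle y^*,F(\hat\xi,\hat x,u)\rangle=\langle y^*,F(\hat\xi,\hat x,\hat u)\rangle=0,\qquad \langle\lambda_1,f(\hat\xi,\hat x)\rangle=0,$$ $$\langle y^*,\hat F''[q,q]\rangle+\langle\lambda_1,\hat f''[(\zeta,h),(\zeta,h)]\rangle+\langle\lambda_2,\hat g''[(\zeta,h),(\zeta,h)]\rangle\ge0 .$$ If $\Lambda(q)=\emptyset$ for some $q\in K$, then system (1) is locally controllable with respect to $(\hat\xi,\hat x,\hat u)$: for every neighbourhood $W$ of $(\hat\xi,\hat x)$ there are neighbourhoods $W_1,W_2$ of the origins of $\mathbb R^{m_1},\mathbb R^{m_2}$ such that for every $y=(y_1,y_2)\in W_1\times W_2$ there is $(\xi_y,x_y,u_y)\in W\times\mathcal U$ with $F(\xi_y,x_y,u_y)=0$,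 $f(\xi_y,x_y)\le y_1$, $g(\xi_y,x_y)=y_2$. Moreover, there is a constant $\kappa_0>0$, independent of $W$ and $y$, such that these points can be chosen with $$\|x_y-\hat x\|_X+|\xi_y-\hat\xi|\le\kappa_0|y|^{1/2}.$$ -/

import Mathlib

open Topology

/-- The data of the abstract control system
`F(ξ, x, u) = 0`, `u ∈ 𝒰`, `f(ξ, x) ≤ 0`, `g(ξ, x) = 0`.
Only the values of `F` at controls `u ∈ 𝒰` matter below. -/
structure ControlSystem (n m₁ m₂ : ℕ) (X Y Z : Type*) where
  /-- the set `𝒰` of controls -/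
  controls : Set Z
  F : EuclideanSpace ℝ (Fin n) × X × Z → Y
  f : EuclideanSpace ℝ (Fin n) × X → EuclideanSpace ℝ (Fin m₁)
  g : EuclideanSpace ℝ (Fin n) × X → EuclideanSpace ℝ (Fin m₂)

/-- `Σᵏ`: the vectors `(α₁, …, αₖ)` with nonnegative entries and sum `< 1`. -/
def mixSimplex (k : ℕ) : Set (Fin k → ℝ) :=
  {α | (∀ i, 0 ≤ α i) ∧ ∑ i, α i < 1}

/-- The weights `(α₀, α₁, …, αₖ)`, where `α₀ = 1 - (α₁ + ⋯ + αₖ)`. -/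
def mixWeights {k : ℕ} (α : Fin k → ℝ) : Fin (k + 1) → ℝ :=
  Fin.cons (1 - ∑ i, α i) α

namespace ControlSystem

variable {n m₁ m₂ : ℕ} {X Y Z : Type*}
  [NormedAddCommGroup X] [NormedSpace ℝ X]
  [NormedAddCommGroup Y] [NormedSpace ℝ Y]
  [NormedAddCommGroup Z] [NormedSpace ℝ Z]

/-- Admissible points: all relations of the system hold and the control is interior to `𝒰`. -/
def IsAdmissible (S : ControlSystem n m₁ m₂ X Y Z)
    (ξ₀ : EuclideanSpace ℝ (Fin n)) (x₀ : X) (u₀ : Z) : Prop :=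
  u₀ ∈ interior S.controls ∧ S.F (ξ₀, x₀, u₀) = 0 ∧
    (∀ i, S.f (ξ₀, x₀) i ≤ 0) ∧ S.g (ξ₀, x₀) = 0

/-- `(ξ, x, u)` solves the system perturbed by `y = (y₁, y₂)`:
`F(ξ, x, u) = 0`, `u ∈ 𝒰`, `f(ξ, x) ≤ y₁` coordinatewise, `g(ξ, x) = y₂`. -/
def SolvesPerturbed (S : ControlSystem n m₁ m₂ X Y Z)
    (y₁ : EuclideanSpace ℝ (Fin m₁)) (y₂ : EuclideanSpace ℝ (Fin m₂))
    (ξ : EuclideanSpace ℝ (Fin n)) (x : X) (u : Z) : Prop :=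
  u ∈ S.controls ∧ S.F (ξ, x, u) = 0 ∧ (∀ i, S.f (ξ, x) i ≤ y₁ i) ∧ S.g (ξ, x) = y₂

/-- Local controllability with respect to `(ξ₀, x₀, u₀)`; it involves only `(ξ₀, x₀)`. -/
def IsLocallyControllable (S : ControlSystem n m₁ m₂ X Y Z)
    (ξ₀ : EuclideanSpace ℝ (Fin n)) (x₀ : X) : Prop :=
  ∀ W ∈ 𝓝 (ξ₀, x₀),
    ∃ W₁ ∈ 𝓝 (0 : EuclideanSpace ℝ (Fin m₁)), ∃ W₂ ∈ 𝓝 (0 : EuclideanSpace ℝ (Fin m₂)),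
      ∀ y₁ ∈ W₁, ∀ y₂ ∈ W₂, ∃ ξ x u, (ξ, x) ∈ W ∧ S.SolvesPerturbed y₁ y₂ ξ x u

/-- The partial derivative `F_ξ(ξ, x, u)`. -/
noncomputable def Fξ (S : ControlSystem n m₁ m₂ X Y Z)
    (ξ : EuclideanSpace ℝ (Fin n)) (x : X) (u : Z) : EuclideanSpace ℝ (Fin n) →L[ℝ] Y :=
  fderiv ℝ (fun ξ' => S.F (ξ', x, u)) ξ

/-- The partial derivative `F_x(ξ, x, u)`. -/
noncomputable def Fx (S : ControlSystem n m₁ m₂ X Y Z)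
    (ξ : EuclideanSpace ℝ (Fin n)) (x : X) (u : Z) : X →L[ℝ] Y :=
  fderiv ℝ (fun x' => S.F (ξ, x', u)) x

/-- Regularity of `F` for all controls near `(ξ₀, x₀)`: on `V × 𝒰` the mapping `F` is continuous,
and for each fixed control `u ∈ 𝒰` the partial derivative `F_x(·, ·, u)` exists and is continuous
on `V`. -/
def IsRegularOn (S : ControlSystem n m₁ m₂ X Y Z)
    (V : Set (EuclideanSpace ℝ (Fin n) × X)) : Prop :=
  ContinuousOn S.F {p | (p.1, p.2.1) ∈ V ∧ p.2.2 ∈ S.controls} ∧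
    ∀ u ∈ S.controls,
      (∀ p ∈ V, DifferentiableAt ℝ (fun x' => S.F (p.1, x', u)) p.2) ∧
        ContinuousOn (fun p : EuclideanSpace ℝ (Fin n) × X => S.Fx p.1 p.2 u) V

/-- Existence of mixes of controls: for all `k ≥ 1` and `ε > 0` there is a mapping
`M = M_ε : Σᵏ × 𝒰ᵏ⁺¹ → 𝒰`, continuous in `α`, such that every point `(ξ₁, x₁, ū₁)`
of `V × 𝒰ᵏ⁺¹` has a neighbourhood on which, for all `α ∈ Σᵏ`, both
`F(ξ, x, M(α, ū))` and `F_x(ξ, x, M(α, ū))` are `ε`-close to the convex combinations. -/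
def HasMixesOn (S : ControlSystem n m₁ m₂ X Y Z)
    (V : Set (EuclideanSpace ℝ (Fin n) × X)) : Prop :=
  ∀ k : ℕ, 1 ≤ k → ∀ ε : ℝ, 0 < ε →
    ∃ M : (Fin k → ℝ) → (Fin (k + 1) → Z) → Z,
      (∀ ū : Fin (k + 1) → Z, (∀ i, ū i ∈ S.controls) →
        (∀ α ∈ mixSimplex k, M α ū ∈ S.controls) ∧
          ContinuousOn (fun α => M α ū) (mixSimplex k)) ∧
      ∀ ξ₁ : EuclideanSpace ℝ (Fin n), ∀ x₁ : X, (ξ₁, x₁) ∈ V →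
        ∀ ū₁ : Fin (k + 1) → Z, (∀ i, ū₁ i ∈ S.controls) →
          ∃ N ∈ 𝓝 (ξ₁, x₁, ū₁), ∀ ξ x ū, (ξ, x, ū) ∈ N → (∀ i, ū i ∈ S.controls) →
            ∀ α ∈ mixSimplex k,
              ‖S.F (ξ, x, M α ū) - ∑ i, mixWeights α i • S.F (ξ, x, ū i)‖ < ε ∧
              ‖S.Fx ξ x (M α ū) - ∑ i, mixWeights α i • S.Fx ξ x (ū i)‖ < ε

/-- The Basic Assumptions at `(ξ₀, x₀, u₀)` (completeness of the spaces is assumed separately).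
`ContDiffAt ℝ 2` says that the mapping has a continuous second derivative in a neighbourhood. -/
structure BasicAssumptions (S : ControlSystem n m₁ m₂ X Y Z)
    (ξ₀ : EuclideanSpace ℝ (Fin n)) (x₀ : X) (u₀ : Z) : Prop where
  contDiffAt_F : ContDiffAt ℝ 2 S.F (ξ₀, x₀, u₀)
  contDiffAt_f : ContDiffAt ℝ 2 S.f (ξ₀, x₀)
  contDiffAt_g : ContDiffAt ℝ 2 S.g (ξ₀, x₀)
  isInvertible_Fx : (S.Fx ξ₀ x₀ u₀).IsInvertible
  exists_mixes : ∃ V : Set (EuclideanSpace ℝ (Fin n) × X),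
    IsOpen V ∧ (ξ₀, x₀) ∈ V ∧ S.IsRegularOn V ∧ S.HasMixesOn V

/-- The cone `K(ξ₀, x₀, u₀)` of critical directions `q = (ζ, h, v)`. -/
def criticalCone (S : ControlSystem n m₁ m₂ X Y Z)
    (ξ₀ : EuclideanSpace ℝ (Fin n)) (x₀ : X) (u₀ : Z) :
    Set (EuclideanSpace ℝ (Fin n) × X × Z) :=
  {q | fderiv ℝ S.F (ξ₀, x₀, u₀) q = 0 ∧
    (∀ i, fderiv ℝ S.f (ξ₀, x₀) (q.1, q.2.1) i ≤ 0) ∧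
    fderiv ℝ S.g (ξ₀, x₀) (q.1, q.2.1) = 0}

/-- The set `Λ(ξ₀, x₀, u₀, q)` of second-order Lagrange multipliers `(y*, λ₁, λ₂)`. -/
def multipliers (S : ControlSystem n m₁ m₂ X Y Z)
    (ξ₀ : EuclideanSpace ℝ (Fin n)) (x₀ : X) (u₀ : Z)
    (q : EuclideanSpace ℝ (Fin n) × X × Z) :
    Set ((Y →L[ℝ] ℝ) × (EuclideanSpace ℝ (Fin m₁) →L[ℝ] ℝ) ×
      (EuclideanSpace ℝ (Fin m₂) →L[ℝ] ℝ)) :=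
  {l | ∃ (yst : Y →L[ℝ] ℝ) (lam₁ : EuclideanSpace ℝ (Fin m₁) →L[ℝ] ℝ)
      (lam₂ : EuclideanSpace ℝ (Fin m₂) →L[ℝ] ℝ), l = (yst, lam₁, lam₂) ∧
    (∀ r : EuclideanSpace ℝ (Fin m₁), (∀ i, 0 ≤ r i) → 0 ≤ lam₁ r) ∧
    ‖lam₁‖ + ‖lam₂‖ ≠ 0 ∧
    yst ∘L S.Fξ ξ₀ x₀ u₀ + lam₁ ∘L fderiv ℝ (fun ξ => S.f (ξ, x₀)) ξ₀
      + lam₂ ∘L fderiv ℝ (fun ξ => S.g (ξ, x₀)) ξ₀ = 0 ∧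
    yst ∘L S.Fx ξ₀ x₀ u₀ + lam₁ ∘L fderiv ℝ (fun x => S.f (ξ₀, x)) x₀
      + lam₂ ∘L fderiv ℝ (fun x => S.g (ξ₀, x)) x₀ = 0 ∧
    IsMinOn (fun u => yst (S.F (ξ₀, x₀, u))) S.controls u₀ ∧
    yst (S.F (ξ₀, x₀, u₀)) = 0 ∧
    lam₁ (S.f (ξ₀, x₀)) = 0 ∧
    0 ≤ yst (fderiv ℝ (fderiv ℝ S.F) (ξ₀, x₀, u₀) q q)
      + lam₁ (fderiv ℝ (fderiv ℝ S.f) (ξ₀, x₀) (q.1, q.2.1) (q.1, q.2.1))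
      + lam₂ (fderiv ℝ (fderiv ℝ S.g) (ξ₀, x₀) (q.1, q.2.1) (q.1, q.2.1))}

end ControlSystem

/-! Fix a critical `q = (ζ, h, v)` without multipliers. The system is tested along parabolas `ξ₀ +
δζ + δ²ζ'`, `x₀ + δh + δ²h'`, with a control mixed from `u₀ + δv` and finitely many fixed controls
`uᵢ` of weights `δ²aᵢ`. Criticality makes the first-order terms of `F` and `g` vanish and those of
`f` nonpositive, so what counts is the system of order `δ²`: `F'(ζ', h', 0) + ½F''[q, q] + ∑ aᵢ
F(ξ₀, x₀, uᵢ) = 0`, `f'(ζ', h') + ½f'' + s f ≤ z₁`, `g'(ζ', h') + ½g'' = z₂`, with `aᵢ ≥ 0` and `s ≥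
0`.

Eliminate `h'` through the invertible `F_x`. The right-hand sides `z` for which this system is
solvable form a convex set in a finite-dimensional space. If it were not a neighbourhood of `0`, a
separating functional would be a multiplier: the free `ζ'` and the elimination of `h'` give the two
adjoint equations, the weights `aᵢ` the minimum condition, `s` complementary slackness, and the
constant terms the second-order inequality (`exists_continuous_solution_or_multipliers`). So `Λ(q) =
∅` makes the system solvable for all small `z`. Taking convex combinations over the vertices of a
simplex around `0`, the solutions depend continuously on `z` and involve finitely many controls
(`exists_continuous_second_order_solution`).

The state equation itself is then solved by a Newton-type argument: the approximate state is
corrected by `o(δ²)`, and the corrected state is continuous in `z` (`exists_continuousOn_state`).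
Hence `g = δ²(z₂ + o(1))` and `f ≤ δ²(z₁ + o(1))`, uniformly in `z`. The inequalities have slack to
absorb the error, while the equation `g = y₂` is solved for `z₂` by Brouwer's theorem
(`exists_le_and_eq_of_norm_sub_le`). This handles `|y|` of order `δ²` with displacement of order
`δ`; choosing `δ` proportional to `|y|^{1/2}` gives the estimate.

Brouwer's theorem is proved by an analytic argument: for a smooth retraction `x + g(x)` of the ball
onto the sphere, the integral of `det(1 + t g')` is a polynomial in `t`, equal to the volume of the
ball for small `t ≥ 0` but to `0` at `t = 1`. -/

/-! ### Brouwer's fixed point theorem -/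

/-- A polynomial interpolation identity for `t ↦ det (1 + t M)`, evaluated at `t = 1`. -/
theorem exists_det_one_add_eq_sum {E : Type*} [NormedAddCommGroup E] [NormedSpace ℝ E]
    [FiniteDimensional ℝ E] (t : Fin (Module.finrank ℝ E + 1) → ℝ) (ht : Function.Injective t) :
    ∃ c : Fin (Module.finrank ℝ E + 1) → ℝ, ∑ j, c j = 1 ∧
      ∀ M : E →L[ℝ] E, (1 + M).det = ∑ j, c j * (1 + t j • M).det := by
  have key : ∀ M : E →L[ℝ] E, (1 + M).det =
      ∑ j, (Lagrange.basis Finset.univ t j).eval 1 * (1 + t j • M).det := by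
    intro M
    let b := Module.finBasis ℝ E
    let A := LinearMap.toMatrix b b (M : E →ₗ[ℝ] E)
    -- As a polynomial in `s`, `det(1 + sM)` has degree at most `dim E`, so `dim E + 1` nodes
    -- determine its value at `1`.
    let p : Polynomial ℝ := Matrix.det
      ((Polynomial.X : Polynomial ℝ) • A.map Polynomial.C +
        (1 : Matrix _ _ ℝ).map Polynomial.C)
    have hp : ∀ s : ℝ, p.eval s = (1 + s • M).det := by
      intro s
      rw [← Polynomial.coe_evalRingHom, RingHom.map_det, ContinuousLinearMap.det,
        ← LinearMap.det_toMatrix b]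
      congr 1
      ext i j
      simp [A, Matrix.one_apply, LinearMap.toMatrix_apply, add_comm, Finsupp.single_apply, eq_comm]
      simp [apply_ite (Polynomial.eval s), mul_comm]
    have hdeg : p.degree < (Finset.univ : Finset (Fin (Module.finrank ℝ E + 1))).card := by
      have h := Polynomial.natDegree_det_X_add_C_le A 1
      refine lt_of_le_of_lt Polynomial.degree_le_natDegree ?_
      simp only [Fintype.card_fin, Finset.card_univ] at h ⊢
      exact_mod_cast Nat.lt_succ_of_le h
    have := Lagrange.eq_interpolate (s := Finset.univ) (v := t) (f := p) ht.injOn hdeg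
    have h1 := hp 1
    rw [one_smul] at h1
    rw [← h1, this, Lagrange.interpolate_apply, Polynomial.eval_finsetSum]
    refine Finset.sum_congr rfl fun j _ => ?_
    rw [Polynomial.eval_mul, Polynomial.eval_C, hp, mul_comm]
  refine ⟨fun j => (Lagrange.basis Finset.univ t j).eval 1, ?_, key⟩
  -- For `M = 0` all determinants equal `1`, which gives `∑ c j = 1`.
  have := key 0
  simpa [ContinuousLinearMap.det] using this.symm

/-- A function that is Lipschitz on the closed unit ball, vanishes on the sphere and outside the
ball, is Lipschitz. -/
theorem LipschitzOnWith.lipschitzWith_of_eq_zero {E F : Type*} [NormedAddCommGroup E]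
    [NormedSpace ℝ E] [NormedAddCommGroup F] {g : E → F} {L : NNReal}
    (hg : LipschitzOnWith L g (Metric.closedBall 0 1)) (h0 : ∀ x, 1 ≤ ‖x‖ → g x = 0) :
    LipschitzWith L g := by
  have mixed : ∀ x y, ‖x‖ ≤ 1 → 1 < ‖y‖ → dist (g x) (g y) ≤ L * dist x y := by
    intro x y hx hy
    have hcont : ContinuousOn (fun s : ℝ => ‖AffineMap.lineMap x y s‖) (Set.Icc 0 1) :=
      (AffineMap.lineMap_continuous.norm).continuousOn
    -- The segment from `x` to `y` crosses the sphere, where `g` vanishes as it does at `y`; the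
    -- Lipschitz bound is applied up to that crossing.
    obtain ⟨s, hs, hs1⟩ := intermediate_value_Icc zero_le_one hcont
      (show (1 : ℝ) ∈ _ by simpa using ⟨hx, hy.le⟩)
    simp only at hs1
    rw [h0 y hy.le, ← h0 _ hs1.ge]
    refine (hg.dist_le_mul x (by simpa using hx) _ (by simp [hs1])).trans ?_
    gcongr
    rw [dist_comm, dist_lineMap_left, Real.norm_eq_abs, abs_of_nonneg hs.1]
    exact mul_le_of_le_one_left dist_nonneg hs.2
  refine LipschitzWith.of_dist_le_mul fun x y => ?_
  rcases le_or_gt ‖x‖ 1 with hx | hx <;> rcases le_or_gt ‖y‖ 1 with hy | hy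
  · exact hg.dist_le_mul x (by simpa using hx) y (by simpa using hy)
  · exact mixed x y hx hy
  · rw [dist_comm, dist_comm x]
    exact mixed y x hy hx
  · rw [h0 x hx.le, h0 y hy.le, dist_self]
    positivity

section Retraction

open MeasureTheory

variable {E : Type*} [NormedAddCommGroup E] [InnerProductSpace ℝ E] [FiniteDimensional ℝ E]

/-- A small Lipschitz perturbation of the identity supported in the unit ball permutes the ball. -/
theorem injective_and_image_ball_of_lipschitz {g : E → E} {L : NNReal} (hg : LipschitzWith L g)
    (h0 : ∀ x, 1 ≤ ‖x‖ → g x = 0) (hL : L < 1) :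
    Function.Injective (fun x => x + g x) ∧
      (fun x => x + g x) '' Metric.ball 0 1 = Metric.ball 0 1 := by
  have happ : ApproximatesLinearOn (fun x => x + g x)
      ((ContinuousLinearEquiv.refl ℝ E : E ≃L[ℝ] E) : E →L[ℝ] E) Set.univ L := by
    rw [ApproximatesLinearOn.approximatesLinearOn_iff_lipschitzOnWith]
    have : (fun x => x + g x) - ⇑((ContinuousLinearEquiv.refl ℝ E : E ≃L[ℝ] E) : E →L[ℝ] E) = g := by
      ext x; simp
    rw [this]
    exact hg.lipschitzOnWith
  have hc : Subsingleton E ∨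
      L < ‖((ContinuousLinearEquiv.refl ℝ E).symm : E →L[ℝ] E)‖₊⁻¹ := by
    rcases subsingleton_or_nontrivial E with h | h
    · exact Or.inl h
    · right
      have : ‖((ContinuousLinearEquiv.refl ℝ E).symm : E →L[ℝ] E)‖₊ = 1 := by
        apply NNReal.eq
        exact ContinuousLinearMap.norm_id
      rw [this]; simpa using hL
  have hinj : Function.Injective (fun x => x + g x) := Set.injOn_univ.mp (happ.injOn hc)
  have hsurj := happ.surjective hc
  refine ⟨hinj, Set.Subset.antisymm ?_ ?_⟩
  · rintro _ ⟨x, hx, rfl⟩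
    by_contra hy
    have hy' : 1 ≤ ‖x + g x‖ := by simpa using hy
    -- Points outside the ball are fixed, so an image landing there would also be the image of
    -- itself.
    have := hinj (a₁ := x + g x) (a₂ := x) (by simp [h0 _ hy'])
    rw [this] at hy'
    simp at hx
    linarith
  · intro y hy
    obtain ⟨x, rfl⟩ := hsurj y
    refine ⟨x, ?_, rfl⟩
    by_contra hx
    have hx' : 1 ≤ ‖x‖ := by simpa using hx
    simp [h0 x hx'] at hy
    linarith

/-- There is no retraction `x ↦ x + g x` of the closed unit ball onto the sphere with `g` Lipschitz
on the space and differentiable in the open ball. -/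
theorem not_norm_add_eq_one_of_lipschitz {g : E → E} {L : NNReal} (hg : LipschitzWith L g)
    (h0 : ∀ x, 1 ≤ ‖x‖ → g x = 0)
    (hd : ∀ x ∈ Metric.ball (0 : E) 1, DifferentiableAt ℝ g x) :
    ¬ ∀ x ∈ Metric.ball (0 : E) 1, ‖x + g x‖ = 1 := by
  intro h1
  borelize E
  obtain ⟨η, hη, hdet⟩ : ∃ η > 0, ∀ M : E →L[ℝ] E, ‖M‖ < η → 0 < (1 + M).det := by
    have hcont : ContinuousAt (fun M : E →L[ℝ] E => (1 + M).det) 0 := by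
      have := (ContinuousLinearMap.continuous_det (𝕜 := ℝ) (E := E))
      exact (this.comp (continuous_const.add continuous_id)).continuousAt
    have h01 : (0 : ℝ) < (1 + (0 : E →L[ℝ] E)).det := by simp [ContinuousLinearMap.det]
    obtain ⟨η, hη, h⟩ := Metric.eventually_nhds_iff.mp (hcont.eventually_const_lt h01)
    exact ⟨η, hη, fun M hM => h (by simpa using hM)⟩
  -- `τ * L < η` keeps the Jacobians positive, `τ * L < 1` keeps `x + t g(x)` a bijection of the
  -- ball.
  obtain ⟨τ, hτ, hτη, hτ1⟩ : ∃ τ : ℝ, 0 < τ ∧ τ * L < η ∧ τ * L < 1 := by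
    have hL : (0 : ℝ) < L + 1 := by positivity
    refine ⟨min η 1 / (L + 1), by positivity, ?_, ?_⟩
    · rw [div_mul_eq_mul_div, div_lt_iff₀ hL]
      have := min_le_left η 1
      have h3 : 0 < min η 1 := by positivity
      nlinarith [L.coe_nonneg]
    · rw [div_mul_eq_mul_div, div_lt_iff₀ hL]
      have := min_le_right η 1
      have h3 : 0 < min η 1 := by positivity
      nlinarith [L.coe_nonneg]
  let t : Fin (Module.finrank ℝ E + 1) → ℝ := fun j => τ / ((j : ℝ) + 1)
  have htinj : Function.Injective t := by
    intro i j hij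
    simp only [t] at hij
    rw [div_eq_div_iff (by positivity) (by positivity)] at hij
    have : (j : ℝ) = i := by
      have := mul_left_cancel₀ hτ.ne' hij
      linarith
    exact Fin.ext (by exact_mod_cast this.symm)
  have htpos : ∀ j, 0 ≤ t j := fun j => by positivity
  have htle : ∀ j, t j ≤ τ := fun j => div_le_self hτ.le (by linarith [(Nat.cast_nonneg (j : ℕ) : (0:ℝ) ≤ _)])
  obtain ⟨c, hc1, hc⟩ := exists_det_one_add_eq_sum (E := E) t htinj
  set B := Metric.ball (0 : E) 1 with hB
  have hnorm : ∀ x, ‖fderiv ℝ g x‖ ≤ L := fun x => norm_fderiv_le_of_lipschitz ℝ hg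
  have main : ∀ j, IntegrableOn (fun x => (1 + t j • fderiv ℝ g x).det) B ∧
      ∫ x in B, (1 + t j • fderiv ℝ g x).det = volume.real B := by
    intro j
    have hgj : LipschitzWith (Real.toNNReal (t j) * L) (fun x => t j • g x) := by
      refine LipschitzWith.of_dist_le_mul fun x y => ?_
      rw [dist_smul₀, Real.norm_eq_abs, abs_of_nonneg (htpos j), NNReal.coe_mul,
        Real.coe_toNNReal _ (htpos j), mul_assoc]
      exact mul_le_mul_of_nonneg_left (hg.dist_le_mul x y) (htpos j)
    have hlt : Real.toNNReal (t j) * L < 1 := by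
      rw [← NNReal.coe_lt_coe, NNReal.coe_mul, Real.coe_toNNReal _ (htpos j), NNReal.coe_one]
      exact (mul_le_mul_of_nonneg_right (htle j) L.coe_nonneg).trans_lt hτ1
    obtain ⟨hinj, himg⟩ := injective_and_image_ball_of_lipschitz hgj
      (fun x hx => by simp [h0 x hx]) hlt
    have hder : ∀ x ∈ B, HasFDerivWithinAt (fun x => x + t j • g x)
        (1 + t j • fderiv ℝ g x) B x := fun x hx =>
      ((hasFDerivAt_id x).add ((hd x hx).hasFDerivAt.const_smul (t j))).hasFDerivWithinAt
    have hpos : ∀ x, 0 < (1 + t j • fderiv ℝ g x).det := by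
      intro x
      apply hdet
      rw [norm_smul, Real.norm_eq_abs, abs_of_nonneg (htpos j)]
      exact (mul_le_mul (htle j) (hnorm x) (norm_nonneg _) hτ.le).trans_lt hτη
    have habs : ∀ x, |(1 + t j • fderiv ℝ g x).det| • (1 : ℝ) = (1 + t j • fderiv ℝ g x).det := by
      intro x; rw [abs_of_pos (hpos x), smul_eq_mul, mul_one]
    constructor
    · have := (integrableOn_image_iff_integrableOn_abs_det_fderiv_smul volume
        measurableSet_ball hder hinj.injOn (fun _ => (1 : ℝ))).mp
        (by rw [himg]; exact integrableOn_const measure_ball_lt_top.ne)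
      simpa only [habs] using this
    · have := integral_image_eq_integral_abs_det_fderiv_smul volume
        measurableSet_ball hder hinj.injOn (fun _ => (1 : ℝ))
      rw [himg] at this
      simp only [habs] at this
      rw [← this]
      simp [hB]
  have hvol : ∫ x in B, (1 + fderiv ℝ g x).det = volume.real B := by
    have hfun : (fun x => (1 + fderiv ℝ g x).det) =
        fun x => ∑ j, c j * (1 + t j • fderiv ℝ g x).det := funext fun x => hc _
    rw [hfun, integral_finsetSum _ fun j _ => ((main j).1.const_mul (c j))]
    simp only [integral_const_mul, (main _).2]
    rw [← Finset.sum_mul, hc1, one_mul]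
  -- Differentiating `‖x + g x‖² = 1` shows that the range of the derivative is orthogonal to the
  -- nonzero vector `x + g x`, so the derivative is not surjective.
  have hzero : ∀ x ∈ B, (1 + fderiv ℝ g x).det = 0 := by
    intro x hx
    have hr : HasFDerivAt (fun x => x + g x) (1 + fderiv ℝ g x) x :=
      (hasFDerivAt_id x).add (hd x hx).hasFDerivAt
    have hns := hr.norm_sq
    have hconst : (fun y => ‖y + g y‖ ^ 2) =ᶠ[𝓝 x] fun _ => (1 : ℝ) := by
      filter_upwards [Metric.isOpen_ball.mem_nhds hx] with y hy
      rw [h1 y hy, one_pow]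
    have huniq := hns.unique ((hasFDerivAt_const (1 : ℝ) x).congr_of_eventuallyEq hconst)
    by_contra hne
    have hsurj : Function.Surjective (1 + fderiv ℝ g x : E →L[ℝ] E) := by
      exact ((Module.End.isUnit_iff _).mp ((LinearMap.isUnit_iff_isUnit_det
        (1 + fderiv ℝ g x : E →L[ℝ] E).toLinearMap).mpr (isUnit_iff_ne_zero.mpr hne))).2
    obtain ⟨v, hv⟩ := hsurj (x + g x)
    have := congrArg (fun T : E →L[ℝ] ℝ => T v) huniq
    simp only [smul_apply, ContinuousLinearMap.comp_apply, hv, innerSL_apply_apply,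
      real_inner_self_eq_norm_sq, h1 x hx] at this
    norm_num at this
  rw [setIntegral_congr_fun measurableSet_ball hzero] at hvol
  have : 0 < volume.real B := by
    rw [measureReal_def]
    exact ENNReal.toReal_pos (Metric.measure_ball_pos _ _ one_pos).ne' measure_ball_lt_top.ne
  simp at hvol
  linarith

end Retraction

section FixedPoint

variable {E : Type*} [NormedAddCommGroup E]

/-- A continuous function on a finite-dimensional space is uniformly approximated by `C¹` ones. -/
theorem Continuous.exists_contDiff_dist_lt {F : Type*} [NormedAddCommGroup F] [NormedSpace ℝ F]
    [NormedSpace ℝ E] [FiniteDimensional ℝ E] {φ : E → F} (hφ : Continuous φ) {ε : ℝ} (hε : 0 < ε) :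
    ∃ ψ : E → F, ContDiff ℝ 1 ψ ∧ ∀ x, dist (ψ x) (φ x) < ε := by
  obtain ⟨g, hg⟩ := exists_contMDiffMap_forall_mem_convex_of_local_const (n := 1)
    (modelWithCornersSelf ℝ E) (t := fun x => Metric.ball (φ x) ε)
    (fun x => convex_ball _ _) fun x => ⟨φ x, by
      filter_upwards [hφ.continuousAt.eventually (Metric.ball_mem_nhds (φ x) hε)] with y hy
      rw [Metric.mem_ball, dist_comm]
      exact hy⟩
  exact ⟨g, contMDiff_iff_contDiff.mp g.contMDiff, hg⟩

/-- A continuous self-map of the closed unit ball whose values have norm at most `r < 1` has a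
fixed point. -/
theorem exists_fixedPoint_of_norm_le_lt_one [InnerProductSpace ℝ E] [FiniteDimensional ℝ E]
    {φ : E → E} {r : ℝ} (hr : r < 1) (hφ : ContinuousOn φ (Metric.closedBall 0 1))
    (hmaps : ∀ x ∈ Metric.closedBall (0 : E) 1, ‖φ x‖ ≤ r) :
    ∃ x ∈ Metric.closedBall (0 : E) 1, φ x = x := by
  by_contra! hne
  have hr0 : 0 ≤ r := (norm_nonneg _).trans (hmaps 0 (by simp))
  let π : E → E := fun x => (max 1 ‖x‖)⁻¹ • x
  have hπc : Continuous π :=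
    (Continuous.inv₀ (by fun_prop) fun x => by positivity).smul continuous_id
  have hπmem : ∀ x, π x ∈ Metric.closedBall (0 : E) 1 := by
    intro x
    rw [mem_closedBall_zero_iff, norm_smul, norm_inv, Real.norm_eq_abs,
      abs_of_pos (by positivity), inv_mul_le_iff₀ (by positivity), mul_one]
    exact le_max_right _ _
  have hπid : ∀ x ∈ Metric.closedBall (0 : E) 1, π x = x := by
    intro x hx
    rw [mem_closedBall_zero_iff] at hx
    simp [π, max_eq_left hx]
  let Φ : E → E := fun x => φ (π x)
  have hΦ : Continuous Φ := hφ.comp_continuous hπc hπmem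
  obtain ⟨x₁, hx₁, hmin⟩ := (isCompact_closedBall (0 : E) 1).exists_isMinOn ⟨0, by simp⟩
    ((continuous_id.sub hΦ).norm.continuousOn)
  set c := ‖x₁ - Φ x₁‖ with hc
  have hc0 : 0 < c := by
    rw [hc, norm_pos_iff, sub_ne_zero]
    intro h
    apply hne x₁ hx₁
    simp only [Φ, hπid x₁ hx₁] at h
    exact h.symm
  -- An error below the minimal displacement `c` creates no fixed point in the ball; an error below
  -- `(1 - r) / 2` keeps the values of norm at most `r' < 1`.
  obtain ⟨ψ, hψ, hψd⟩ := hΦ.exists_contDiff_dist_lt (ε := min c ((1 - r) / 2))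
    (lt_min hc0 (by linarith))
  set r' := (1 + r) / 2 with hr'
  have hψle : ∀ x, ‖ψ x‖ ≤ r' := by
    intro x
    have h1 := (hψd x).trans_le (min_le_right _ _)
    have h2 := hmaps (π x) (hπmem x)
    rw [dist_eq_norm] at h1
    have := norm_le_norm_add_norm_sub' (ψ x) (Φ x)
    simp only [Φ] at this h1
    linarith
  have hψne : ∀ x ∈ Metric.closedBall (0 : E) 1, x ≠ ψ x := by
    intro x hx h
    have h1 := (hψd x).trans_le (min_le_left _ _)
    have h2 : c ≤ ‖x - Φ x‖ := hmin hx
    rw [← h, dist_eq_norm] at h1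
    linarith
  -- The bump is `1` on the ball of radius `r'`, where a zero of `x - χ ψ` would be a fixed point of
  -- `ψ`; beyond it `‖χ ψ‖ ≤ r' < ‖x‖`. So `Ψ` never vanishes, is the identity off the unit ball,
  -- and normalizes to a retraction.
  let χ : ContDiffBump (0 : E) := ⟨r', 1, by linarith, by linarith⟩
  let Ψ : E → E := fun x => x - χ x • ψ x
  have hΨ : ContDiff ℝ 1 Ψ := contDiff_id.sub (χ.contDiff.smul hψ)
  have hΨ0 : ∀ x, Ψ x ≠ 0 := by
    intro x h
    have hx : x = χ x • ψ x := sub_eq_zero.mp h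
    rcases le_or_gt ‖x‖ r' with hle | hlt
    · have h1 : χ x = 1 := χ.one_of_mem_closedBall (by simpa using hle)
      rw [h1, one_smul] at hx
      exact hψne x (by simp; linarith) hx
    · have h2 : ‖χ x • ψ x‖ ≤ r' := by
        rw [norm_smul, Real.norm_eq_abs, abs_of_nonneg χ.nonneg]
        exact (mul_le_of_le_one_left (norm_nonneg _) χ.le_one).trans (hψle x)
      rw [← hx] at h2
      linarith
  have hΨid : ∀ x, 1 ≤ ‖x‖ → Ψ x = x := by
    intro x hx
    have : χ x = 0 := χ.zero_of_le_dist (by simpa using hx)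
    simp [Ψ, this]
  let G : E → E := fun x => ‖Ψ x‖⁻¹ • Ψ x - x
  have hG : ContDiff ℝ 1 G :=
    (((hΨ.norm ℝ hΨ0).inv fun x => norm_ne_zero_iff.mpr (hΨ0 x)).smul hΨ).sub contDiff_id
  obtain ⟨L, hL⟩ := (hG.locallyLipschitz.locallyLipschitzOn
    (s := Metric.closedBall 0 1)).exists_lipschitzOnWith_of_compact (isCompact_closedBall 0 1)
  let g : E → E := fun x => if ‖x‖ < 1 then G x else 0
  have hgG : ∀ x ∈ Metric.closedBall (0 : E) 1, g x = G x := by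
    intro x hx
    rw [mem_closedBall_zero_iff] at hx
    rcases hx.lt_or_eq with h | h
    · simp [g, h]
    · simp [g, G, hΨid x h.ge, h]
  have hg0 : ∀ x, 1 ≤ ‖x‖ → g x = 0 := fun x hx => by simp [g, hx.not_gt]
  refine not_norm_add_eq_one_of_lipschitz
    (LipschitzOnWith.lipschitzWith_of_eq_zero (L := L) (fun x hx y hy => ?_) hg0) hg0
    (fun x hx => ?_) (fun x hx => ?_)
  · rw [hgG x hx, hgG y hy]
    exact hL hx hy
  · refine ((hG.differentiable one_ne_zero) x).congr_of_eventuallyEq ?_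
    filter_upwards [Metric.isOpen_ball.mem_nhds hx] with y hy
    exact hgG y (Metric.ball_subset_closedBall hy)
  · rw [hgG x (Metric.ball_subset_closedBall hx)]
    simp only [G, add_sub_cancel, norm_smul, norm_inv, norm_norm]
    exact inv_mul_cancel₀ (norm_ne_zero_iff.mpr (hΨ0 x))

/-- A continuous function on the closed ball of radius `ρ` that differs from the identity by at most
`a` attains every value of norm at most `b` when `a + b < ρ`. -/
theorem exists_eq_of_norm_sub_id_le [InnerProductSpace ℝ E] [FiniteDimensional ℝ E]
    {G : E → E} {ρ a b : ℝ} (hρ : 0 < ρ) (hab : a + b < ρ)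
    (hG : ContinuousOn G (Metric.closedBall 0 ρ))
    (ha : ∀ z ∈ Metric.closedBall (0 : E) ρ, ‖G z - z‖ ≤ a) {w : E} (hw : ‖w‖ ≤ b) :
    ∃ z ∈ Metric.closedBall (0 : E) ρ, G z = w := by
  have hmem : ∀ x ∈ Metric.closedBall (0 : E) 1, ρ • x ∈ Metric.closedBall (0 : E) ρ := by
    intro x hx
    rw [mem_closedBall_zero_iff] at hx ⊢
    rw [norm_smul, Real.norm_eq_abs, abs_of_pos hρ]
    exact mul_le_of_le_one_right hρ.le hx
  -- On the rescaled ball, the solutions of `G z = w` are the fixed points of `z - (G z - w)`, whose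
  -- values have norm at most `a + b < ρ`.
  obtain ⟨x, hx, hfix⟩ := exists_fixedPoint_of_norm_le_lt_one
    (φ := fun x => x - ρ⁻¹ • (G (ρ • x) - w)) (r := (a + b) / ρ)
    (by rwa [div_lt_one hρ])
    (continuousOn_id.sub (((hG.comp (continuous_const_smul ρ).continuousOn hmem).sub
      continuousOn_const).const_smul ρ⁻¹))
    (by
      intro x hx
      have : x - ρ⁻¹ • (G (ρ • x) - w) = ρ⁻¹ • (w - (G (ρ • x) - ρ • x)) := by
        rw [← sub_eq_zero, smul_sub, smul_sub, smul_sub, smul_smul, inv_mul_cancel₀ hρ.ne', one_smul]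
        abel
      rw [this, norm_smul, norm_inv, Real.norm_eq_abs, abs_of_pos hρ, inv_mul_le_iff₀ hρ,
        mul_div_cancel₀ _ hρ.ne']
      refine (norm_sub_le _ _).trans ?_
      linarith [ha _ (hmem x hx)])
  refine ⟨ρ • x, hmem x hx, ?_⟩
  have : ρ⁻¹ • (G (ρ • x) - w) = 0 := by simpa using hfix
  rcases smul_eq_zero.mp this with h | h
  · exact absurd h (inv_ne_zero hρ.ne')
  · exact sub_eq_zero.mp h

end FixedPoint

/-! ### Convex separation and the multiplier alternative -/

/-- In a finite-dimensional space, a convex set that is not a neighbourhood of the origin lies in a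
closed half-space bounded by a hyperplane through the origin. -/
theorem Convex.exists_nonneg_of_notMem_nhds {E : Type*} [NormedAddCommGroup E] [NormedSpace ℝ E]
    [FiniteDimensional ℝ E] {C : Set E} (hC : Convex ℝ C) (hne : C.Nonempty) (h0 : C ∉ 𝓝 0) :
    ∃ l : E →L[ℝ] ℝ, l ≠ 0 ∧ ∀ c ∈ C, 0 ≤ l c := by
  by_cases hint : (interior C).Nonempty
  · obtain ⟨l, u, hl, hlC, hu⟩ := geometric_hahn_banach_of_nonempty_interior hC
      (convex_singleton (0 : E)) (by
        rw [Set.disjoint_singleton_right]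
        rwa [mem_interior_iff_mem_nhds]) hint (Set.singleton_nonempty 0)
    refine ⟨-l, neg_ne_zero.mpr hl, fun c hc => ?_⟩
    have h1 := hlC c hc
    have h2 : u ≤ l 0 := hu 0 rfl
    simp at h2 ⊢
    linarith
  · rw [hC.interior_nonempty_iff_affineSpan_eq_top] at hint
    obtain ⟨p, hp⟩ := hne
    have hpa := subset_affineSpan ℝ C hp
    have hD : (affineSpan ℝ C).direction < ⊤ := by
      rw [lt_top_iff_ne_top]
      intro h
      exact hint ((AffineSubspace.direction_eq_top_iff_of_nonempty ⟨p, hpa⟩).mp h)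
    -- With empty interior the affine hull is proper, so some nonzero functional is constant on `C`;
    -- its sign can be adjusted.
    obtain ⟨l, hl, hker⟩ := Submodule.exists_le_ker_of_lt_top _ hD
    have hconst : ∀ c ∈ C, l c = l p := by
      intro c hc
      have := hker (AffineSubspace.vsub_mem_direction (subset_affineSpan ℝ C hc) hpa)
      rw [LinearMap.mem_ker, vsub_eq_sub, map_sub, sub_eq_zero] at this
      exact this
    have hl' : LinearMap.toContinuousLinearMap l ≠ 0 := by
      intro h
      apply hl
      ext x
      simpa using congrArg (fun T : E →L[ℝ] ℝ => T x) h
    rcases le_total 0 (l p) with h | h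
    · exact ⟨LinearMap.toContinuousLinearMap l, hl', fun c hc => by simp [hconst c hc, h]⟩
    · exact ⟨-LinearMap.toContinuousLinearMap l, neg_ne_zero.mpr hl',
        fun c hc => by simp [hconst c hc, h]⟩

/-- A negative slope would violate the bound for large `t`. This turns a lower bound along a ray of
the cone into a sign condition on a multiplier. -/
theorem nonneg_of_forall_add_mul_nonneg {a b : ℝ} (h : ∀ t : ℝ, 0 ≤ t → 0 ≤ a + t * b) :
    0 ≤ b := by
  by_contra! hb
  have := h ((|a| + 1) / -b) (by have := neg_pos.mpr hb; positivity)
  rw [div_mul_eq_mul_div, div_neg, mul_div_cancel_right₀ _ hb.ne] at this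
  linarith [le_abs_self a]

/-- An alternative for a system of affine inequalities and equations over a convex cone. -/
theorem mem_nhds_or_exists_multipliers {W : Type*} [AddCommGroup W] [Module ℝ W] {m₁ m₂ : ℕ}
    {P : Set W} (hP : Convex ℝ P) (hP0 : (0 : W) ∈ P) (hPs : ∀ t : ℝ, 0 ≤ t → ∀ w ∈ P, t • w ∈ P)
    (A : W →ₗ[ℝ] EuclideanSpace ℝ (Fin m₁)) (B : W →ₗ[ℝ] EuclideanSpace ℝ (Fin m₂))
    (a : EuclideanSpace ℝ (Fin m₁)) (b : EuclideanSpace ℝ (Fin m₂)) :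
    {z : EuclideanSpace ℝ (Fin m₁) × EuclideanSpace ℝ (Fin m₂) |
        ∃ w ∈ P, (∀ i, (A w + a) i ≤ z.1 i) ∧ B w + b = z.2} ∈ 𝓝 0 ∨
      ∃ (l₁ : EuclideanSpace ℝ (Fin m₁) →L[ℝ] ℝ) (l₂ : EuclideanSpace ℝ (Fin m₂) →L[ℝ] ℝ),
        (∀ r : EuclideanSpace ℝ (Fin m₁), (∀ i, 0 ≤ r i) → 0 ≤ l₁ r) ∧ ‖l₁‖ + ‖l₂‖ ≠ 0 ∧
        (∀ w ∈ P, 0 ≤ l₁ (A w) + l₂ (B w)) ∧ 0 ≤ l₁ a + l₂ b := by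
  rw [or_iff_not_imp_left]
  intro h0
  set C := {z : EuclideanSpace ℝ (Fin m₁) × EuclideanSpace ℝ (Fin m₂) |
        ∃ w ∈ P, (∀ i, (A w + a) i ≤ z.1 i) ∧ B w + b = z.2} with hCdef
  have hconv : Convex ℝ C := by
    rintro z ⟨w, hw, hz1, hz2⟩ z' ⟨w', hw', hz1', hz2'⟩ s t hs ht hst
    refine ⟨s • w + t • w', hP hw hw' hs ht hst, fun i => ?_, ?_⟩
    · have h1 := mul_le_mul_of_nonneg_left (hz1 i) hs
      have h2 := mul_le_mul_of_nonneg_left (hz1' i) ht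
      simp at h1 h2 ⊢
      have : a i = s * a i + t * a i := by rw [← add_mul, hst, one_mul]
      linarith
    · rw [map_add, map_smul, map_smul]
      have : b = s • b + t • b := by rw [← add_smul, hst, one_smul]
      simp only [Prod.snd_add, Prod.smul_snd, ← hz2, ← hz2']
      nth_rewrite 1 [this]
      rw [smul_add, smul_add]
      abel
  -- The set `C` is closed under increasing the first component; this is what makes `l₁`
  -- nonnegative.
  have hmem : ∀ w ∈ P, ∀ r : EuclideanSpace ℝ (Fin m₁), (∀ i, 0 ≤ r i) →
      (A w + a + r, B w + b) ∈ C := fun w hw r hr =>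
    ⟨w, hw, fun i => by simpa using hr i, rfl⟩
  obtain ⟨l, hl, hlC⟩ := hconv.exists_nonneg_of_notMem_nhds
    ⟨_, hmem 0 hP0 0 fun i => by simp⟩ h0
  let l₁ := l.comp (ContinuousLinearMap.inl ℝ (EuclideanSpace ℝ (Fin m₁)) (EuclideanSpace ℝ (Fin m₂)))
  let l₂ := l.comp (ContinuousLinearMap.inr ℝ (EuclideanSpace ℝ (Fin m₁)) (EuclideanSpace ℝ (Fin m₂)))
  have hsplit : ∀ z, l z = l₁ z.1 + l₂ z.2 := by
    intro z
    simp only [l₁, l₂, ContinuousLinearMap.comp_apply, ← map_add]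
    simp
  have hlow : ∀ w ∈ P, ∀ r : EuclideanSpace ℝ (Fin m₁), (∀ i, 0 ≤ r i) →
      0 ≤ l₁ (A w) + l₁ a + l₁ r + (l₂ (B w) + l₂ b) := by
    intro w hw r hr
    have := hlC _ (hmem w hw r hr)
    rw [hsplit] at this
    simpa only [map_add] using this
  refine ⟨l₁, l₂, fun r hr => ?_, fun h => ?_, fun w hw => ?_, ?_⟩
  · apply nonneg_of_forall_add_mul_nonneg (a := l₁ a + l₂ b)
    intro t ht
    have := hlow 0 hP0 (t • r) fun i => by simpa using mul_nonneg ht (hr i)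
    simp at this
    linarith
  · have h1 : l₁ = 0 := norm_eq_zero.mp (by linarith [norm_nonneg l₁, norm_nonneg l₂])
    have h2 : l₂ = 0 := norm_eq_zero.mp (by linarith [norm_nonneg l₁, norm_nonneg l₂])
    apply hl
    ext z
    · have := congrArg (fun T => T z) h1
      simpa [l₁] using this
    · have := congrArg (fun T => T z) h2
      simpa [l₂] using this
  · apply nonneg_of_forall_add_mul_nonneg (a := l₁ a + l₂ b)
    intro t ht
    have := hlow (t • w) (hPs t ht w hw) 0 fun i => by simp
    simp at this
    linarith
  · have := hlow 0 hP0 0 fun i => by simp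
    simpa using this

/-- Points near the origin are continuous convex combinations of finitely many points of a given
neighbourhood of the origin. -/
theorem exists_continuous_barycentric {E : Type*} [NormedAddCommGroup E] [NormedSpace ℝ E]
    [FiniteDimensional ℝ E] {C : Set E} (hC : C ∈ 𝓝 0) :
    ∃ (N : ℕ) (c : Fin N → E) (w : Fin N → E → ℝ) (ρ : ℝ), 0 < ρ ∧ (∀ j, c j ∈ C) ∧
      (∀ j, Continuous (w j)) ∧ ∀ z, ‖z‖ ≤ ρ →
        (∀ j, 0 ≤ w j z) ∧ ∑ j, w j z = 1 ∧ ∑ j, w j z • c j = z := by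
  obtain ⟨b, hb0, hbC⟩ := exists_mem_interior_convexHull_affineBasis hC
  obtain ⟨ρ, hρ, hball⟩ := Metric.nhds_basis_closedBall.mem_iff.mp
    (mem_interior_iff_mem_nhds.mp hb0)
  refine ⟨_, b, fun j z => b.coord j z, ρ, hρ, fun j => hbC (subset_convexHull ℝ _ ⟨j, rfl⟩),
    fun j => continuous_barycentric_coord b j, fun z hz => ⟨?_, b.sum_coord_apply_eq_one z, ?_⟩⟩
  · have := hball (mem_closedBall_zero_iff.mpr hz)
    rw [b.convexHull_eq_nonneg_coord] at this
    exact this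
  · exact b.linear_combination_coord_eq_self z

/-- If an affine system over a convex set is solvable for all right-hand sides near the origin, then
it has solutions that are continuous convex combinations of finitely many points. -/
theorem exists_continuous_convex_combination {W : Type*} [AddCommGroup W] [Module ℝ W] {m₁ m₂ : ℕ}
    {P : Set W}
    (A : W →ₗ[ℝ] EuclideanSpace ℝ (Fin m₁)) (B : W →ₗ[ℝ] EuclideanSpace ℝ (Fin m₂))
    (a : EuclideanSpace ℝ (Fin m₁)) (b : EuclideanSpace ℝ (Fin m₂))
    (hC : {z : EuclideanSpace ℝ (Fin m₁) × EuclideanSpace ℝ (Fin m₂) |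
        ∃ w ∈ P, (∀ i, (A w + a) i ≤ z.1 i) ∧ B w + b = z.2} ∈ 𝓝 0) :
    ∃ (N : ℕ) (p : Fin N → W)
      (w : Fin N → EuclideanSpace ℝ (Fin m₁) × EuclideanSpace ℝ (Fin m₂) → ℝ) (ρ : ℝ), 0 < ρ ∧
      (∀ j, p j ∈ P) ∧ (∀ j, Continuous (w j)) ∧ ∀ z, ‖z‖ ≤ ρ → (∀ j, 0 ≤ w j z) ∧
        (∀ i, (A (∑ j, w j z • p j) + a) i ≤ z.1 i) ∧ B (∑ j, w j z • p j) + b = z.2 := by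
  obtain ⟨N, c, w, ρ, hρ, hcC, hwc, hw⟩ := exists_continuous_barycentric hC
  choose p hpP hpa hpb using hcC
  refine ⟨N, p, w, ρ, hρ, hpP, hwc, fun z hz => ?_⟩
  obtain ⟨hw0, hw1, hwz⟩ := hw z hz
  have hA : A (∑ j, w j z • p j) + a = ∑ j, w j z • (A (p j) + a) := by
    simp only [smul_add, Finset.sum_add_distrib, ← Finset.sum_smul, hw1, one_smul, map_sum, map_smul]
  have hB : B (∑ j, w j z • p j) + b = ∑ j, w j z • (B (p j) + b) := by
    simp only [smul_add, Finset.sum_add_distrib, ← Finset.sum_smul, hw1, one_smul, map_sum, map_smul]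
  refine ⟨hw0, fun i => ?_, ?_⟩
  · rw [hA]
    have hz1 : z.1 i = ∑ j, w j z * (c j).1 i := by
      conv_lhs => rw [← hwz]
      simp [Prod.fst_sum]
    rw [hz1]
    simp only [WithLp.ofLp_sum, Finset.sum_apply, WithLp.ofLp_smul, Pi.smul_apply, smul_eq_mul]
    exact Finset.sum_le_sum fun j _ => mul_le_mul_of_nonneg_left (hpa j i) (hw0 j)
  · rw [hB]
    conv_rhs => rw [← hwz]
    simp only [hpb, Prod.snd_sum, Prod.smul_snd]

/-- Finitely many finitely supported functions are supported in the range of a finite sequence. -/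
theorem exists_fin_linearCombination_eq {ι Y : Type*} [Nonempty ι] [AddCommGroup Y] [Module ℝ Y]
    (b : ι → Y) {N : ℕ} (p : Fin N → ι →₀ ℝ) :
    ∃ (k : ℕ) (u : Fin k → ι), 1 ≤ k ∧ ∀ w : Fin N → ℝ,
      Finsupp.linearCombination ℝ b (∑ j, w j • p j) =
        ∑ i, (∑ j, w j * p j (u i)) • b (u i) := by
  classical
  obtain ⟨j₀⟩ := ‹Nonempty ι›
  -- The extra index `j₀` guarantees `k ≥ 1`, as mixes of controls are only available then.
  let S : Finset ι := insert j₀ (Finset.univ.biUnion fun j => (p j).support)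
  let e := S.equivFin.symm
  refine ⟨S.card, fun i => e i, Finset.card_pos.mpr ⟨j₀, Finset.mem_insert_self _ _⟩, fun w => ?_⟩
  have happ : ∀ t, (∑ j, w j • p j) t = ∑ j, w j * p j t := fun t => by
    simp [Finsupp.finsetSum_apply]
  simp only [← happ]
  rw [Finsupp.linearCombination_apply, Finsupp.sum_of_support_subset (s := S)]
  · rw [← Finset.sum_coe_sort S]
    exact (Equiv.sum_comp e fun t : S => (∑ j, w j • p j) t • b t).symm
  · intro t ht
    by_contra hS
    rw [Finsupp.mem_support_iff, happ] at ht
    apply ht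
    refine Finset.sum_eq_zero fun j _ => ?_
    have : p j t = 0 := by
      by_contra hne
      exact hS (Finset.mem_insert_of_mem (Finset.mem_biUnion.mpr
        ⟨j, Finset.mem_univ _, Finsupp.mem_support_iff.mpr hne⟩))
    rw [this, mul_zero]
  · simp

/-- The alternative of `exists_continuous_solution_or_multipliers`, with the variations, the weights
and the multiple of `f₀` read off an abstract vector `w : W`. -/
theorem exists_continuous_solution_or_multipliers_aux {W : Type*} [AddCommGroup W] [Module ℝ W]
    {m₁ m₂ : ℕ} {V X Y ι : Type*} [Nonempty ι]
    [NormedAddCommGroup V] [NormedSpace ℝ V] [NormedAddCommGroup X] [NormedSpace ℝ X]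
    [NormedAddCommGroup Y] [NormedSpace ℝ Y]
    (p₁ : W →ₗ[ℝ] V) (p₂ : W →ₗ[ℝ] (ι →₀ ℝ)) (p₃ : W →ₗ[ℝ] ℝ)
    (hp : ∀ v a s, ∃ w, p₁ w = v ∧ p₂ w = a ∧ p₃ w = s)
    (T : V →L[ℝ] Y) (A : X ≃L[ℝ] Y) (b : ι → Y)
    (Df : V × X →L[ℝ] EuclideanSpace ℝ (Fin m₁)) (Dg : V × X →L[ℝ] EuclideanSpace ℝ (Fin m₂))
    (f₀ τf : EuclideanSpace ℝ (Fin m₁)) (hf₀ : ∀ i, f₀ i ≤ 0) (τg : EuclideanSpace ℝ (Fin m₂))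
    (τF : Y) :
    (∃ (k : ℕ) (u : Fin k → ι) (ρ : ℝ)
        (ζ : EuclideanSpace ℝ (Fin m₁) × EuclideanSpace ℝ (Fin m₂) → V)
        (h : EuclideanSpace ℝ (Fin m₁) × EuclideanSpace ℝ (Fin m₂) → X)
        (a : Fin k → EuclideanSpace ℝ (Fin m₁) × EuclideanSpace ℝ (Fin m₂) → ℝ)
        (s : EuclideanSpace ℝ (Fin m₁) × EuclideanSpace ℝ (Fin m₂) → ℝ),
        1 ≤ k ∧ 0 < ρ ∧ Continuous ζ ∧ Continuous h ∧ (∀ i, Continuous (a i)) ∧ Continuous s ∧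
        ∀ z, ‖z‖ ≤ ρ → (∀ i, 0 ≤ a i z) ∧ 0 ≤ s z ∧
          T (ζ z) + A (h z) + τF + ∑ i, a i z • b (u i) = 0 ∧
          (∀ i, (Df (ζ z, h z) + τf + s z • f₀) i ≤ z.1 i) ∧ Dg (ζ z, h z) + τg = z.2) ∨
      ∃ (yst : Y →L[ℝ] ℝ) (l₁ : EuclideanSpace ℝ (Fin m₁) →L[ℝ] ℝ)
        (l₂ : EuclideanSpace ℝ (Fin m₂) →L[ℝ] ℝ),
        (∀ r : EuclideanSpace ℝ (Fin m₁), (∀ i, 0 ≤ r i) → 0 ≤ l₁ r) ∧ ‖l₁‖ + ‖l₂‖ ≠ 0 ∧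
        (∀ v, yst (T v) + l₁ (Df (v, 0)) + l₂ (Dg (v, 0)) = 0) ∧
        (∀ x, yst (A x) + l₁ (Df (0, x)) + l₂ (Dg (0, x)) = 0) ∧
        (∀ j, 0 ≤ yst (b j)) ∧ l₁ f₀ = 0 ∧ 0 ≤ yst τF + l₁ τf + l₂ τg := by
  let P : Set W := {w | (∀ j, 0 ≤ p₂ w j) ∧ 0 ≤ p₃ w}
  have hP : Convex ℝ P := by
    rintro w ⟨hw, hw'⟩ v ⟨hv, hv'⟩ s t hs ht -
    refine ⟨fun j => ?_, ?_⟩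
    · rw [map_add, map_smul, map_smul]
      exact add_nonneg (mul_nonneg hs (hw j)) (mul_nonneg ht (hv j))
    · rw [map_add, map_smul, map_smul]
      exact add_nonneg (mul_nonneg hs hw') (mul_nonneg ht hv')
  have hP0 : (0 : W) ∈ P := ⟨fun _ => by simp, by simp⟩
  have hPs : ∀ t : ℝ, 0 ≤ t → ∀ w ∈ P, t • w ∈ P := fun t ht w hw =>
    ⟨fun j => by rw [map_smul]; exact mul_nonneg ht (hw.1 j),
      by rw [map_smul]; exact mul_nonneg ht hw.2⟩
  -- The state variation splits into `H w`, linear in the unknowns, and the constant `h₀ = -A⁻¹ τF`.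
  obtain ⟨H, hH⟩ : ∃ H : W →ₗ[ℝ] X,
      ∀ w, H w = -A.symm (T (p₁ w) + Finsupp.linearCombination ℝ b (p₂ w)) :=
    ⟨-(A.symm.toLinearMap.comp (T.toLinearMap.comp p₁ +
      (Finsupp.linearCombination ℝ b).comp p₂)), fun _ => rfl⟩
  obtain ⟨Φ, hΦ⟩ : ∃ Φ : W →ₗ[ℝ] EuclideanSpace ℝ (Fin m₁),
      ∀ w, Φ w = Df (p₁ w, H w) + p₃ w • f₀ :=
    ⟨Df.toLinearMap.comp (p₁.prod H) + p₃.smulRight f₀, fun _ => rfl⟩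
  obtain ⟨Γ, hΓ⟩ : ∃ Γ : W →ₗ[ℝ] EuclideanSpace ℝ (Fin m₂), ∀ w, Γ w = Dg (p₁ w, H w) :=
    ⟨Dg.toLinearMap.comp (p₁.prod H), fun _ => rfl⟩
  obtain ⟨h₀, hh₀⟩ : ∃ h₀ : X, h₀ = -A.symm τF := ⟨_, rfl⟩
  rcases mem_nhds_or_exists_multipliers hP hP0 hPs
    Φ Γ (Df (0, h₀) + τf) (Dg (0, h₀) + τg) with hC | ⟨l₁, l₂, hl₁, hl, hlP, hl0⟩
  · left
    obtain ⟨N, p, w, ρ, hρ, hpP, hwc, hw⟩ := exists_continuous_convex_combination _ _ _ _ hC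
    obtain ⟨k, u, hk, hu⟩ := exists_fin_linearCombination_eq b fun j => p₂ (p j)
    refine ⟨k, u, ρ, fun z => ∑ j, w j z • p₁ (p j), fun z => ∑ j, w j z • H (p j) + h₀,
      fun i z => ∑ j, w j z * p₂ (p j) (u i), fun z => ∑ j, w j z * p₃ (p j), hk, hρ,
      by fun_prop, by fun_prop, fun i => by fun_prop, by fun_prop, fun z hz => ?_⟩
    obtain ⟨hw0, hwf, hwg⟩ := hw z hz
    obtain ⟨ω, hW⟩ : ∃ ω, ω = ∑ j, w j z • p j := ⟨_, rfl⟩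
    have hW1 : ∑ j, w j z • p₁ (p j) = p₁ ω := by simp [hW]
    have hW2 : ∑ j, w j z • p₂ (p j) = p₂ ω := by simp [hW]
    have hW3 : ∑ j, w j z * p₃ (p j) = p₃ ω := by simp [hW]
    have hHW : ∑ j, w j z • H (p j) = H ω := by simp only [hW, map_sum, map_smul]
    rw [← hW] at hwf hwg
    rw [hΓ] at hwg
    simp only [hΦ] at hwf
    beta_reduce
    rw [← hu, hHW, hW1, hW2, hW3]
    have hsum : ∀ {m : ℕ} (D : V × X →L[ℝ] EuclideanSpace ℝ (Fin m)),
        D (p₁ ω, H ω + h₀) = D (p₁ ω, H ω) + D (0, h₀) := by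
      intro m D
      rw [← map_add, Prod.mk_add_mk, add_zero]
    refine ⟨fun i => Finset.sum_nonneg fun j _ => mul_nonneg (hw0 j) ((hpP j).1 _),
      hW3 ▸ Finset.sum_nonneg fun j _ => mul_nonneg (hw0 j) (hpP j).2, ?_, fun i => ?_, ?_⟩
    · rw [map_add, hH, hh₀, map_neg, map_neg, A.apply_symm_apply, A.apply_symm_apply]
      abel
    · refine le_trans (le_of_eq ?_) (hwf i)
      exact congrArg (fun v : EuclideanSpace ℝ (Fin m₁) => v i) (by rw [hsum]; abel)
    · rw [hsum, ← hwg]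
      abel
  · right
    -- The adjoint equation in `x` forces this choice of `y*`, as `A` is invertible.
    obtain ⟨yst, hy⟩ : ∃ yst : Y →L[ℝ] ℝ,
        ∀ y, yst y = -(l₁ (Df (0, A.symm y)) + l₂ (Dg (0, A.symm y))) :=
      ⟨-((l₁.comp (Df.comp (ContinuousLinearMap.inr ℝ V X)) +
        l₂.comp (Dg.comp (ContinuousLinearMap.inr ℝ V X))).comp (A.symm : Y →L[ℝ] X)),
        fun _ => rfl⟩
    have hneg : ∀ {m : ℕ} (D : V × X →L[ℝ] EuclideanSpace ℝ (Fin m)) (x : X),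
        D (0, -x) = - D (0, x) := by
      intro m D x
      rw [← map_neg, Prod.neg_mk, neg_zero]
    have hsplit : ∀ {m : ℕ} (D : V × X →L[ℝ] EuclideanSpace ℝ (Fin m)) (v : V) (x : X),
        D (v, x) = D (v, 0) + D (0, x) := by
      intro m D v x
      rw [← map_add, Prod.mk_add_mk, add_zero, zero_add]
    have h00 : ((0, 0) : V × X) = 0 := rfl
    have hval : ∀ v a s, (∀ j, 0 ≤ a j) → 0 ≤ s → 0 ≤ l₁ (Df (v, 0)) + l₂ (Dg (v, 0)) +
        yst (T v + Finsupp.linearCombination ℝ b a) + s * l₁ f₀ := by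
      intro v a s ha hs
      obtain ⟨w, rfl, rfl, rfl⟩ := hp v a s
      refine (hlP w ⟨ha, hs⟩).trans_eq ?_
      rw [hΦ, hΓ, hsplit, hsplit Dg, hH, hneg, hneg, hy]
      simp only [map_add, map_neg, map_smul, smul_eq_mul]
      ring
    refine ⟨yst, l₁, l₂, hl₁, hl, fun v => ?_, fun x => ?_, fun j => ?_, ?_, ?_⟩
    · have key : ∀ v, 0 ≤ yst (T v) + l₁ (Df (v, 0)) + l₂ (Dg (v, 0)) := by
        intro v
        have := hval v 0 0 (fun _ => le_rfl) le_rfl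
        rw [map_zero, add_zero, zero_mul] at this
        linarith
      have h1 := key v
      have h2 := key (-v)
      rw [show ((-v, 0) : V × X) = -(v, 0) by simp] at h2
      simp only [map_neg] at h2
      linarith
    · rw [hy, ContinuousLinearEquiv.symm_apply_apply]
      ring
    · have := hval 0 (Finsupp.single j 1) 0 (fun t => by
        classical
        simp only [Finsupp.single_apply]; split_ifs <;> norm_num) le_rfl
      simpa [h00] using this
    -- The variable `s` gives `l₁ f₀ ≥ 0`; the reverse inequality holds because `f₀ ≤ 0` and `l₁ ≥
    -- 0`.
    · have h1 := hval 0 0 1 (fun _ => le_rfl) zero_le_one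
      have h2 := hl₁ (-f₀) fun i => by simpa using hf₀ i
      simp [h00] at h1 h2
      linarith
    · have h1 : yst τF + l₁ τf + l₂ τg = l₁ (Df (0, h₀) + τf) + l₂ (Dg (0, h₀) + τg) := by
        rw [hy, hh₀, hneg, hneg]
        simp only [map_add, map_neg]
        ring
      rw [h1]
      exact hl0

/-- Either the convexified second-order system, in which the state variation is eliminated through
the invertible operator `A`, is solvable for all small right-hand sides, with solutions depending
continuously on them and using finitely many of the vectors `b`, or there are Lagrange
multipliers. -/
theorem exists_continuous_solution_or_multipliers {m₁ m₂ : ℕ} {V X Y ι : Type*} [Nonempty ι]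
    [NormedAddCommGroup V] [NormedSpace ℝ V] [NormedAddCommGroup X] [NormedSpace ℝ X]
    [NormedAddCommGroup Y] [NormedSpace ℝ Y]
    (T : V →L[ℝ] Y) (A : X ≃L[ℝ] Y) (b : ι → Y)
    (Df : V × X →L[ℝ] EuclideanSpace ℝ (Fin m₁)) (Dg : V × X →L[ℝ] EuclideanSpace ℝ (Fin m₂))
    (f₀ τf : EuclideanSpace ℝ (Fin m₁)) (hf₀ : ∀ i, f₀ i ≤ 0) (τg : EuclideanSpace ℝ (Fin m₂))
    (τF : Y) :
    (∃ (k : ℕ) (u : Fin k → ι) (ρ : ℝ)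
        (ζ : EuclideanSpace ℝ (Fin m₁) × EuclideanSpace ℝ (Fin m₂) → V)
        (h : EuclideanSpace ℝ (Fin m₁) × EuclideanSpace ℝ (Fin m₂) → X)
        (a : Fin k → EuclideanSpace ℝ (Fin m₁) × EuclideanSpace ℝ (Fin m₂) → ℝ)
        (s : EuclideanSpace ℝ (Fin m₁) × EuclideanSpace ℝ (Fin m₂) → ℝ),
        1 ≤ k ∧ 0 < ρ ∧ Continuous ζ ∧ Continuous h ∧ (∀ i, Continuous (a i)) ∧ Continuous s ∧
        ∀ z, ‖z‖ ≤ ρ → (∀ i, 0 ≤ a i z) ∧ 0 ≤ s z ∧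
          T (ζ z) + A (h z) + τF + ∑ i, a i z • b (u i) = 0 ∧
          (∀ i, (Df (ζ z, h z) + τf + s z • f₀) i ≤ z.1 i) ∧ Dg (ζ z, h z) + τg = z.2) ∨
      ∃ (yst : Y →L[ℝ] ℝ) (l₁ : EuclideanSpace ℝ (Fin m₁) →L[ℝ] ℝ)
        (l₂ : EuclideanSpace ℝ (Fin m₂) →L[ℝ] ℝ),
        (∀ r : EuclideanSpace ℝ (Fin m₁), (∀ i, 0 ≤ r i) → 0 ≤ l₁ r) ∧ ‖l₁‖ + ‖l₂‖ ≠ 0 ∧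
        (∀ v, yst (T v) + l₁ (Df (v, 0)) + l₂ (Dg (v, 0)) = 0) ∧
        (∀ x, yst (A x) + l₁ (Df (0, x)) + l₂ (Dg (0, x)) = 0) ∧
        (∀ j, 0 ≤ yst (b j)) ∧ l₁ f₀ = 0 ∧ 0 ≤ yst τF + l₁ τf + l₂ τg := by
  exact exists_continuous_solution_or_multipliers_aux (W := V × (ι →₀ ℝ) × ℝ)
    (LinearMap.fst ℝ _ _) ((LinearMap.fst ℝ _ _).comp (LinearMap.snd ℝ _ _))
    ((LinearMap.snd ℝ _ _).comp (LinearMap.snd ℝ _ _)) (fun v a s => ⟨(v, a, s), rfl, rfl, rfl⟩)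
    T A b Df Dg f₀ τf hf₀ τg τF

/-! ### Second-order expansions along parabolas -/

section Taylor

variable {E G : Type*} [NormedAddCommGroup E] [NormedSpace ℝ E] [NormedAddCommGroup G]
  [NormedSpace ℝ G]

theorem eventually_mul_lt (C : ℝ) {ε : ℝ} (hε : 0 < ε) : ∀ᶠ δ : ℝ in 𝓝[>] 0, δ * C < ε := by
  have h : Filter.Tendsto (fun δ : ℝ => δ * C) (𝓝[>] 0) (𝓝 0) := by
    have : Filter.Tendsto (fun δ : ℝ => δ * C) (𝓝 0) (𝓝 (0 * C)) :=
      (continuous_id.mul continuous_const).tendsto 0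
    rw [zero_mul] at this
    exact this.mono_left nhdsWithin_le_nhds
  exact h.eventually_lt_const hε

/-- A property that holds near `p` holds along all the parabolas `p + δ q + δ² w` with `w` bounded,
for small `δ > 0`. -/
theorem Filter.Eventually.parabola {p : E} {Q : E → Prop} (hQ : ∀ᶠ x in 𝓝 p, Q x) (q : E) (R : ℝ) :
    ∀ᶠ δ : ℝ in 𝓝[>] 0, ∀ w, ‖w‖ ≤ R → Q (p + δ • q + δ ^ 2 • w) := by
  obtain ⟨η, hη, h⟩ := Metric.eventually_nhds_iff.mp hQ
  filter_upwards [eventually_mul_lt (‖q‖ + |R|) hη, eventually_mul_lt 1 one_pos,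
    self_mem_nhdsWithin] with δ h1 h2 h0 w hw
  have h0 : 0 < δ := h0
  apply h
  rw [dist_eq_norm, add_assoc, add_sub_cancel_left]
  refine (norm_add_le _ _).trans_lt (lt_of_le_of_lt ?_ h1)
  rw [norm_smul, norm_smul, Real.norm_eq_abs, Real.norm_eq_abs, abs_of_pos h0,
    abs_of_pos (by positivity), mul_add]
  have : δ ^ 2 ≤ δ := by nlinarith
  gcongr
  exact hw.trans (le_abs_self R)

/-- Second-order Taylor expansion with the Peano remainder. -/
theorem ContDiffAt.eventually_norm_taylor_two_le {Φ : E → G} {p : E} (hΦ : ContDiffAt ℝ 2 Φ p)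
    {ε : ℝ} (hε : 0 < ε) :
    ∀ᶠ x in 𝓝 p, ‖Φ x - Φ p - fderiv ℝ Φ p (x - p) -
      (1 / 2 : ℝ) • fderiv ℝ (fderiv ℝ Φ) p (x - p) (x - p)‖ ≤ ε * ‖x - p‖ ^ 2 := by
  have hD : HasFDerivAt (fderiv ℝ Φ) (fderiv ℝ (fderiv ℝ Φ) p) p :=
    ((hΦ.fderiv_right (m := 1) (by norm_num)).differentiableAt one_ne_zero).hasFDerivAt
  have hsymm : IsSymmSndFDerivAt ℝ Φ p := hΦ.isSymmSndFDerivAt (by simp)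
  have hdiff : ∀ᶠ x in 𝓝 p, DifferentiableAt ℝ Φ x :=
    (hΦ.eventually (by simp)).mono fun x hx => hx.differentiableAt two_ne_zero
  obtain ⟨η, hη, h⟩ := Metric.eventually_nhds_iff_ball.mp (hdiff.and (hD.isLittleO.def hε))
  filter_upwards [Metric.ball_mem_nhds p hη] with x hx
  have hsub : Metric.closedBall p ‖x - p‖ ⊆ Metric.ball p η := by
    apply Metric.closedBall_subset_ball
    rwa [mem_ball_iff_norm] at hx
  -- The derivative of the remainder is the first-order remainder of `Φ'`, hence at most `ε‖x - p‖`
  -- on this ball; the mean value inequality supplies the second factor.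
  have hder : ∀ y ∈ Metric.closedBall p ‖x - p‖, HasFDerivWithinAt
      (fun y => Φ y - Φ p - fderiv ℝ Φ p (y - p) -
        (1 / 2 : ℝ) • fderiv ℝ (fderiv ℝ Φ) p (y - p) (y - p))
      (fderiv ℝ Φ y - fderiv ℝ Φ p - fderiv ℝ (fderiv ℝ Φ) p (y - p))
      (Metric.closedBall p ‖x - p‖) y := by
    intro y hy
    have hid : HasFDerivAt (fun y => y - p) (ContinuousLinearMap.id ℝ E) y :=
      (hasFDerivAt_id y).sub_const p
    have h1 := (h y (hsub hy)).1.hasFDerivAt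
    have h2 := (fderiv ℝ Φ p).hasFDerivAt.comp y hid
    have h3 := ((fderiv ℝ (fderiv ℝ Φ) p).hasFDerivAt_of_bilinear hid hid).const_smul (1 / 2 : ℝ)
    refine (((h1.sub_const (Φ p)).sub h2).sub h3).hasFDerivWithinAt.congr_fderiv ?_
    ext v
    have := hsymm v (y - p)
    simp only [ContinuousLinearMap.precompR, ContinuousLinearMap.precompL, sub_apply, smul_apply,
      add_apply, ContinuousLinearMap.comp_apply, ContinuousLinearMap.id_apply,
      ContinuousLinearMap.compL_apply, ContinuousLinearMap.flip_apply, this]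
    module
  have hbound : ∀ y ∈ Metric.closedBall p ‖x - p‖,
      ‖fderiv ℝ Φ y - fderiv ℝ Φ p - fderiv ℝ (fderiv ℝ Φ) p (y - p)‖ ≤ ε * ‖x - p‖ := by
    intro y hy
    refine ((h y (hsub hy)).2).trans ?_
    gcongr
    rwa [mem_closedBall_iff_norm] at hy
  have := (convex_closedBall p ‖x - p‖).norm_image_sub_le_of_norm_hasFDerivWithin_le hder hbound
    (Metric.mem_closedBall_self (norm_nonneg _)) (by rw [mem_closedBall_iff_norm])
  simp only [sub_self, map_zero, smul_zero, sub_zero] at this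
  rwa [mul_assoc, ← pow_two] at this

/-- The second-order expansion along the parabolas `p + δ q + δ² w`, uniformly in bounded `w`. -/
theorem ContDiffAt.eventually_norm_parabola_le {Φ : E → G} {p : E} (hΦ : ContDiffAt ℝ 2 Φ p)
    (q : E) (R : ℝ) {ε : ℝ} (hε : 0 < ε) :
    ∀ᶠ δ : ℝ in 𝓝[>] 0, ∀ w, ‖w‖ ≤ R →
      ‖Φ (p + δ • q + δ ^ 2 • w) - (Φ p + δ • fderiv ℝ Φ p q +
        δ ^ 2 • (fderiv ℝ Φ p w + (1 / 2 : ℝ) • fderiv ℝ (fderiv ℝ Φ) p q q))‖ ≤ ε * δ ^ 2 := by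
  set D := fderiv ℝ Φ p
  set B := fderiv ℝ (fderiv ℝ Φ) p
  set C := ‖q‖ + |R| + 1 with hC
  have hC0 : 0 < C := by positivity
  filter_upwards [(hΦ.eventually_norm_taylor_two_le (ε := ε / (2 * C ^ 2)) (by positivity)).parabola
    q R, eventually_mul_lt (‖B‖ * C ^ 2) (show 0 < ε / 3 by positivity), eventually_mul_lt 1 one_pos,
    self_mem_nhdsWithin] with δ h1 h2 h3 h0 w hw
  have h0 : 0 < δ := h0
  have hδ1 : δ ≤ 1 := by linarith
  specialize h1 w hw
  have hwC : ‖w‖ ≤ C := by linarith [le_abs_self R, norm_nonneg q]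
  have hqC : ‖q‖ ≤ C := by linarith [abs_nonneg R]
  set v := δ • q + δ ^ 2 • w with hv
  have hpv : p + δ • q + δ ^ 2 • w - p = v := by rw [hv]; abel
  rw [hpv] at h1
  have hvn : ‖v‖ ≤ δ * C := by
    refine (norm_add_le _ _).trans ?_
    rw [norm_smul, norm_smul, Real.norm_eq_abs, Real.norm_eq_abs, abs_of_pos h0,
      abs_of_pos (by positivity)]
    have h4 : δ ^ 2 ≤ δ := by nlinarith
    have h5 : δ ^ 2 * ‖w‖ ≤ δ * |R| := mul_le_mul h4 (hw.trans (le_abs_self R)) (norm_nonneg _) h0.le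
    rw [hC]
    nlinarith
  -- All terms involving `w` carry a factor `δ³`, so they are negligible uniformly in bounded `w`.
  have hB : B v v = δ ^ 2 • B q q + δ ^ 3 • (B q w + B w q + δ • B w w) := by
    simp only [hv, map_add, map_smul, add_apply, smul_apply]
    module
  have hDv : D v = δ • D q + δ ^ 2 • D w := by simp [hv]
  have heq : Φ (p + δ • q + δ ^ 2 • w) - (Φ p + δ • D q + δ ^ 2 • (D w + (1 / 2 : ℝ) • B q q)) =
      (Φ (p + δ • q + δ ^ 2 • w) - Φ p - D v - (1 / 2 : ℝ) • B v v) +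
        (δ ^ 3 / 2) • (B q w + B w q + δ • B w w) := by
    rw [hB, hDv]
    module
  rw [heq]
  have hb : ∀ a b : E, ‖a‖ ≤ C → ‖b‖ ≤ C → ‖B a b‖ ≤ ‖B‖ * C ^ 2 := by
    intro a b ha hb
    refine (B.le_opNorm₂ a b).trans ?_
    rw [mul_assoc, pow_two]
    gcongr
  have hthird : ‖B q w + B w q + δ • B w w‖ ≤ 3 * (‖B‖ * C ^ 2) := by
    have e1 := hb q w hqC hwC
    have e2 := hb w q hwC hqC
    have e3 : ‖δ • B w w‖ ≤ ‖B‖ * C ^ 2 := by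
      rw [norm_smul, Real.norm_eq_abs, abs_of_pos h0]
      exact (mul_le_of_le_one_left (norm_nonneg _) hδ1).trans (hb w w hwC hwC)
    have e4 := norm_add_le (B q w + B w q) (δ • B w w)
    have e5 := norm_add_le (B q w) (B w q)
    linarith
  have h6 : ‖(δ ^ 3 / 2) • (B q w + B w q + δ • B w w)‖ ≤ δ ^ 2 * (3 / 2 * (δ * (‖B‖ * C ^ 2))) := by
    rw [norm_smul, Real.norm_eq_abs, abs_of_pos (by positivity)]
    calc δ ^ 3 / 2 * ‖B q w + B w q + δ • B w w‖ ≤ δ ^ 3 / 2 * (3 * (‖B‖ * C ^ 2)) := by gcongr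
      _ = _ := by ring
  have h7 : ε / (2 * C ^ 2) * ‖v‖ ^ 2 ≤ ε / 2 * δ ^ 2 := by
    calc ε / (2 * C ^ 2) * ‖v‖ ^ 2 ≤ ε / (2 * C ^ 2) * (δ * C) ^ 2 := by gcongr
      _ = _ := by field_simp
  have h8 : δ ^ 2 * (3 / 2 * (δ * (‖B‖ * C ^ 2))) ≤ δ ^ 2 * (ε / 2) := by
    apply mul_le_mul_of_nonneg_left _ (by positivity)
    linarith
  refine (norm_add_le _ _).trans ?_
  linarith

end Taylor

/-! ### Quantitative inversion of maps close to an invertible operator -/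

section Newton

variable {X Y : Type*} [NormedAddCommGroup X] [NormedSpace ℝ X] [NormedAddCommGroup Y]
  [NormedSpace ℝ Y]

theorem approximatesLinearOn_of_norm_fderiv_sub_le {A : X →L[ℝ] Y} {Φ : X → Y} {s : Set X}
    (hs : Convex ℝ s) {c : NNReal} (hd : ∀ x ∈ s, DifferentiableAt ℝ Φ x)
    (hc : ∀ x ∈ s, ‖fderiv ℝ Φ x - A‖ ≤ c) : ApproximatesLinearOn Φ A s c :=
  fun _ hx _ hy => hs.norm_image_sub_le_of_norm_fderiv_le' hd hc hy hx

/-- Half of the bound `‖x - y‖ ≤ ‖A⁻¹‖ ‖A(x - y)‖` survives the nonlinear error. It later yields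
continuity of the corrected state in the parameter. -/
theorem ApproximatesLinearOn.norm_sub_le_two_mul {A : X ≃L[ℝ] Y} {Φ : X → Y} {s : Set X}
    {c : NNReal} (h : ApproximatesLinearOn Φ (A : X →L[ℝ] Y) s c)
    (hc : ‖(A.symm : Y →L[ℝ] X)‖ * c ≤ 1 / 2) {x y : X} (hx : x ∈ s) (hy : y ∈ s) :
    ‖x - y‖ ≤ 2 * ‖(A.symm : Y →L[ℝ] X)‖ * ‖Φ x - Φ y‖ := by
  have h1 : ‖x - y‖ ≤ ‖(A.symm : Y →L[ℝ] X)‖ * ‖A (x - y)‖ := by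
    have := (A.symm : Y →L[ℝ] X).le_opNorm (A (x - y))
    simpa using this
  have h2 : ‖A (x - y)‖ ≤ ‖Φ x - Φ y‖ + c * ‖x - y‖ := by
    have h3 := h x hx y hy
    have h4 := norm_sub_norm_le (A (x - y)) (Φ x - Φ y)
    rw [norm_sub_rev (A (x - y))] at h4
    simp only [ContinuousLinearEquiv.coe_coe] at h3
    linarith
  have h5 : ‖(A.symm : Y →L[ℝ] X)‖ * (c * ‖x - y‖) ≤ 1 / 2 * ‖x - y‖ := by
    rw [← mul_assoc]
    gcongr
  have h6 := mul_le_mul_of_nonneg_left h2 (norm_nonneg (A.symm : Y →L[ℝ] X))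
  rw [mul_add] at h6
  linarith

/-- Since `‖A⁻¹‖ c ≤ 1/2`, the image of a ball of radius `2‖A⁻¹‖‖Φ x‖` about `x` covers the ball of
radius `‖Φ x‖` about `Φ x`, which contains `0`. -/
theorem ApproximatesLinearOn.exists_eq_zero [CompleteSpace X] {A : X ≃L[ℝ] Y} {Φ : X → Y}
    {s : Set X} {c : NNReal} (h : ApproximatesLinearOn Φ (A : X →L[ℝ] Y) s c)
    (hc : ‖(A.symm : Y →L[ℝ] X)‖ * c ≤ 1 / 2) {x : X}
    (hx : Metric.closedBall x (2 * ‖(A.symm : Y →L[ℝ] X)‖ * ‖Φ x‖) ⊆ s) :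
    ∃ x' ∈ Metric.closedBall x (2 * ‖(A.symm : Y →L[ℝ] X)‖ * ‖Φ x‖), Φ x' = 0 := by
  rcases eq_or_ne (Φ x) 0 with h0 | h0
  · exact ⟨x, by simp [h0], h0⟩
  have hN : 0 < ‖(A.symm : Y →L[ℝ] X)‖ := by
    rw [norm_pos_iff]
    intro hA
    apply h0
    have := congrArg (fun T : Y →L[ℝ] X => A (T (Φ x))) hA
    simpa using this
  obtain ⟨x', hx', h'⟩ := h.surjOn_closedBall_of_nonlinearRightInverse A.toNonlinearRightInverse
    (by positivity) hx (show (0 : Y) ∈ _ by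
      rw [mem_closedBall_iff_norm, zero_sub, norm_neg]
      change ‖Φ x‖ ≤ (‖(A.symm : Y →L[ℝ] X)‖⁻¹ - c) * (2 * ‖(A.symm : Y →L[ℝ] X)‖ * ‖Φ x‖)
      have e : (‖(A.symm : Y →L[ℝ] X)‖⁻¹ - c) * (2 * ‖(A.symm : Y →L[ℝ] X)‖ * ‖Φ x‖) =
          2 * (1 - ‖(A.symm : Y →L[ℝ] X)‖ * c) * ‖Φ x‖ := by
        field_simp
      rw [e]
      exact le_mul_of_one_le_left (norm_nonneg _) (by linarith))
  exact ⟨x', hx', h'⟩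

end Newton

/-! ### Mixed controls and the state equation -/

namespace ControlSystem

variable {n m₁ m₂ : ℕ} {X Y Z : Type*}
  [NormedAddCommGroup X] [NormedSpace ℝ X]
  [NormedAddCommGroup Y] [NormedSpace ℝ Y]
  [NormedAddCommGroup Z] [NormedSpace ℝ Z]
  (S : ControlSystem n m₁ m₂ X Y Z)

/-- The partial derivatives in terms of the full derivative. -/
theorem Fx_apply_eq {ξ : EuclideanSpace ℝ (Fin n)} {x : X} {u : Z}
    (h : DifferentiableAt ℝ S.F (ξ, x, u)) (h' : X) :
    S.Fx ξ x u h' = fderiv ℝ S.F (ξ, x, u) (0, h', 0) := by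
  have h1 : HasFDerivAt (fun x' : X => ((ξ, x', u) : EuclideanSpace ℝ (Fin n) × X × Z))
      ((0 : X →L[ℝ] EuclideanSpace ℝ (Fin n)).prod
        ((ContinuousLinearMap.id ℝ X).prod (0 : X →L[ℝ] Z))) x :=
    (hasFDerivAt_const ξ x).prodMk ((hasFDerivAt_id x).prodMk (hasFDerivAt_const u x))
  have h2 := (h.hasFDerivAt.comp x h1).fderiv
  rw [Fx]
  exact congrArg (fun T : X →L[ℝ] Y => T h') h2

theorem Fξ_apply_eq {ξ : EuclideanSpace ℝ (Fin n)} {x : X} {u : Z}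
    (h : DifferentiableAt ℝ S.F (ξ, x, u)) (ζ : EuclideanSpace ℝ (Fin n)) :
    S.Fξ ξ x u ζ = fderiv ℝ S.F (ξ, x, u) (ζ, 0, 0) := by
  have h1 : HasFDerivAt (fun ξ' => ((ξ', x, u) : EuclideanSpace ℝ (Fin n) × X × Z))
      ((ContinuousLinearMap.id ℝ (EuclideanSpace ℝ (Fin n))).prod
        ((0 : EuclideanSpace ℝ (Fin n) →L[ℝ] X).prod (0 : EuclideanSpace ℝ (Fin n) →L[ℝ] Z))) ξ :=
    (hasFDerivAt_id ξ).prodMk ((hasFDerivAt_const x ξ).prodMk (hasFDerivAt_const u ξ))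
  have h2 := (h.hasFDerivAt.comp ξ h1).fderiv
  rw [Fξ]
  exact congrArg (fun T : EuclideanSpace ℝ (Fin n) →L[ℝ] Y => T ζ) h2

/-- Near `u₀` the partial derivative is a restriction of the continuous full derivative, so it is
jointly continuous, control included; for distant fixed controls only continuity in `(ξ, x)` is
assumed. -/
theorem eventually_norm_Fx_sub_lt {ξ₀ : EuclideanSpace ℝ (Fin n)} {x₀ : X} {u₀ : Z}
    (hF : ContDiffAt ℝ 2 S.F (ξ₀, x₀, u₀)) {c : ℝ} (hc : 0 < c) :
    ∀ᶠ p : EuclideanSpace ℝ (Fin n) × X × Z in 𝓝 (ξ₀, x₀, u₀),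
      ‖S.Fx p.1 p.2.1 p.2.2 - S.Fx ξ₀ x₀ u₀‖ < c := by
  have hcont : ContinuousAt (fderiv ℝ S.F) (ξ₀, x₀, u₀) :=
    (hF.fderiv_right (m := 1) (by norm_num)).continuousAt
  have hdiff : ∀ᶠ p in 𝓝 (ξ₀, x₀, u₀), DifferentiableAt ℝ S.F p :=
    (hF.eventually (by simp)).mono fun x hx => hx.differentiableAt two_ne_zero
  filter_upwards [hdiff, hcont.eventually (Metric.ball_mem_nhds _ (half_pos hc))] with p hp hpc
  rw [dist_eq_norm] at hpc
  refine lt_of_le_of_lt (ContinuousLinearMap.opNorm_le_bound _ (half_pos hc).le fun h' => ?_)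
    (half_lt_self hc)
  rw [sub_apply, S.Fx_apply_eq (hF.differentiableAt two_ne_zero), S.Fx_apply_eq hp, ← sub_apply]
  refine (ContinuousLinearMap.le_opNorm _ _).trans ?_
  refine mul_le_mul hpc.le ?_ (norm_nonneg _) (half_pos hc).le
  simp

theorem sum_mixWeights_smul {k : ℕ} {G : Type*} [AddCommGroup G] [Module ℝ G] (α : Fin k → ℝ)
    {W : Type*} (c : W → G) (u₀ : W) (u : Fin k → W) :
    ∑ i, mixWeights α i • c ((Fin.cons u₀ u : Fin (k + 1) → W) i) =
      (1 - ∑ i, α i) • c u₀ + ∑ i, α i • c (u i) := by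
  rw [Fin.sum_univ_succ]
  simp [mixWeights]

/-- Near `(ξ₀, x₀)` the derivative `F_x` at mixes of a control close to `u₀` with fixed controls of
weights of order `δ²` is close to `F_x(ξ₀, x₀, u₀)`. -/
theorem exists_eventually_norm_mix_Fx_sub_le {ξ₀ : EuclideanSpace ℝ (Fin n)} {x₀ : X} {u₀ : Z}
    (hF : ContDiffAt ℝ 2 S.F (ξ₀, x₀, u₀)) {V : Set (EuclideanSpace ℝ (Fin n) × X)}
    (hV : V ∈ 𝓝 (ξ₀, x₀)) (hreg : S.IsRegularOn V) {k : ℕ} (u : Fin k → Z)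
    (hu : ∀ i, u i ∈ S.controls) (v : Z) (R : ℝ) {c : ℝ} (hc : 0 < c) :
    ∃ r > 0, Metric.closedBall (ξ₀, x₀) r ⊆ V ∧ ∀ᶠ δ : ℝ in 𝓝[>] 0,
      ∀ ξ x, (ξ, x) ∈ Metric.closedBall (ξ₀, x₀) r → ∀ a : Fin k → ℝ, (∀ i, 0 ≤ a i) →
        (∀ i, a i ≤ R) → ∀ L : X →L[ℝ] Y,
        ‖L - ∑ i, mixWeights (fun i => δ ^ 2 * a i) i •
          S.Fx ξ x ((Fin.cons (u₀ + δ • v) u : Fin (k + 1) → Z) i)‖ ≤ δ ^ 3 →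
        ‖L - S.Fx ξ₀ x₀ u₀‖ ≤ c := by
  set A := S.Fx ξ₀ x₀ u₀ with hA
  obtain ⟨K, hK0, hK⟩ : ∃ K : ℝ, 0 ≤ K ∧ ∀ i, ‖S.Fx ξ₀ x₀ (u i) - A‖ < K := by
    refine ⟨∑ i, ‖S.Fx ξ₀ x₀ (u i) - A‖ + 1, by positivity, fun i => ?_⟩
    have := Finset.single_le_sum (f := fun i => ‖S.Fx ξ₀ x₀ (u i) - A‖)
      (fun j _ => norm_nonneg _) (Finset.mem_univ i)
    linarith
  have h1 : ∀ᶠ p : EuclideanSpace ℝ (Fin n) × X in 𝓝 (ξ₀, x₀),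
      p ∈ V ∧ ∀ i, ‖S.Fx p.1 p.2 (u i) - A‖ < K := by
    refine Filter.Eventually.and hV ?_
    rw [Filter.eventually_all]
    intro i
    have hcont := ((hreg.2 (u i) (hu i)).2.continuousAt hV)
    exact (hcont.sub continuousAt_const).norm.eventually_lt_const (hK i)
  have h2 := S.eventually_norm_Fx_sub_lt hF (show 0 < c / 3 by positivity)
  obtain ⟨r₁, hr₁, h1⟩ := Metric.nhds_basis_closedBall.eventually_iff.mp h1
  obtain ⟨r₂, hr₂, h2⟩ := Metric.nhds_basis_closedBall.eventually_iff.mp h2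
  refine ⟨min r₁ r₂, lt_min hr₁ hr₂, fun p hp =>
    (h1 (Metric.closedBall_subset_closedBall (min_le_left _ _) hp)).1, ?_⟩
  filter_upwards [self_mem_nhdsWithin, eventually_mul_lt 1 one_pos,
    eventually_mul_lt ‖v‖ hr₂, eventually_mul_lt 1 (show 0 < c / 3 by positivity),
    eventually_mul_lt (k * R * K) (show 0 < c / 3 by positivity),
    eventually_mul_lt (k * R) one_pos] with δ h0 hδ1 hv hc1 hc2 hc3 ξ x hξx a ha haR L hL
  have h0 : 0 < δ := h0
  have hδ2 : δ ^ 2 ≤ δ := by nlinarith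
  rw [sum_mixWeights_smul _ (fun u => S.Fx ξ x u)] at hL
  have hsum : ∑ i, a i ≤ k * R := by
    have := Finset.sum_le_sum fun i (_ : i ∈ Finset.univ) => haR i
    simpa using this
  have hsum0 : 0 ≤ ∑ i, a i := Finset.sum_nonneg fun i _ => ha i
  have hw : ∑ i, δ ^ 2 * a i ≤ δ * (k * R) := by
    rw [← Finset.mul_sum]
    exact mul_le_mul hδ2 hsum hsum0 h0.le
  have hw0 : 0 ≤ ∑ i, δ ^ 2 * a i := Finset.sum_nonneg fun i _ => by have := ha i; positivity
  have hb0 : ‖S.Fx ξ x (u₀ + δ • v) - A‖ ≤ c / 3 := by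
    refine (h2 (x := (ξ, x, u₀ + δ • v)) ?_).le
    have := Metric.closedBall_subset_closedBall (min_le_right r₁ r₂) hξx
    rw [Metric.mem_closedBall, Prod.dist_eq, max_le_iff] at this
    rw [Metric.mem_closedBall, Prod.dist_eq, max_le_iff, Prod.dist_eq, max_le_iff]
    refine ⟨this.1, this.2, ?_⟩
    simp [norm_smul, abs_of_pos h0, hv.le]
  have hbi : ∀ i, ‖S.Fx ξ x (u i) - A‖ ≤ K := fun i =>
    ((h1 (Metric.closedBall_subset_closedBall (min_le_left _ _) hξx)).2 i).le
  -- Three errors, each at most `c / 3`: that of the mix, that of the control `u₀ + δv`, and that of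
  -- the fixed controls, whose total weight is `O(δ²)`.
  have heq : L - A = (L - ((1 - ∑ i, δ ^ 2 * a i) • S.Fx ξ x (u₀ + δ • v) +
      ∑ i, (δ ^ 2 * a i) • S.Fx ξ x (u i))) +
      (1 - ∑ i, δ ^ 2 * a i) • (S.Fx ξ x (u₀ + δ • v) - A) +
      ∑ i, (δ ^ 2 * a i) • (S.Fx ξ x (u i) - A) := by
    simp only [smul_sub, Finset.sum_sub_distrib, ← Finset.sum_smul]
    module
  rw [heq]
  have e1 : ‖(1 - ∑ i, δ ^ 2 * a i) • (S.Fx ξ x (u₀ + δ • v) - A)‖ ≤ c / 3 := by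
    rw [norm_smul, Real.norm_eq_abs, abs_of_nonneg (by linarith)]
    exact (mul_le_of_le_one_left (norm_nonneg _) (by linarith)).trans hb0
  have e2 : ‖∑ i, (δ ^ 2 * a i) • (S.Fx ξ x (u i) - A)‖ ≤ c / 3 := by
    refine (norm_sum_le _ _).trans ?_
    calc ∑ i, ‖(δ ^ 2 * a i) • (S.Fx ξ x (u i) - A)‖ ≤ ∑ i, (δ ^ 2 * a i) * K := by
          refine Finset.sum_le_sum fun i _ => ?_
          have := ha i
          rw [norm_smul, Real.norm_eq_abs, abs_of_nonneg (by positivity)]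
          exact mul_le_mul_of_nonneg_left (hbi i) (by positivity)
      _ = (∑ i, δ ^ 2 * a i) * K := by rw [Finset.sum_mul]
      _ ≤ δ * (k * R) * K := by gcongr
      _ ≤ c / 3 := by linarith
  have e3 : δ ^ 3 ≤ c / 3 := by nlinarith
  refine (norm_add₃_le).trans ?_
  linarith

/-- The residual of the state equation at the second-order approximation of the state, for mixes
whose weights satisfy the second-order equation. -/
theorem eventually_norm_mix_le {ξ₀ : EuclideanSpace ℝ (Fin n)} {x₀ : X} {u₀ : Z}
    (hF : ContDiffAt ℝ 2 S.F (ξ₀, x₀, u₀)) (hF0 : S.F (ξ₀, x₀, u₀) = 0)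
    {V : Set (EuclideanSpace ℝ (Fin n) × X)} (hV : V ∈ 𝓝 (ξ₀, x₀)) (hreg : S.IsRegularOn V)
    {k : ℕ} (u : Fin k → Z) (hu : ∀ i, u i ∈ S.controls)
    {ζ : EuclideanSpace ℝ (Fin n)} {h : X} {v : Z}
    (hq : fderiv ℝ S.F (ξ₀, x₀, u₀) (ζ, h, v) = 0) (R : ℝ) {η : ℝ} (hη : 0 < η) :
    ∀ᶠ δ : ℝ in 𝓝[>] 0, ∀ ζ' h', ‖ζ'‖ ≤ R → ‖h'‖ ≤ R → ∀ a : Fin k → ℝ, (∀ i, 0 ≤ a i) →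
      (∀ i, a i ≤ R) → fderiv ℝ S.F (ξ₀, x₀, u₀) (ζ', h', 0) + (1 / 2 : ℝ) •
        fderiv ℝ (fderiv ℝ S.F) (ξ₀, x₀, u₀) (ζ, h, v) (ζ, h, v) +
        ∑ i, a i • S.F (ξ₀, x₀, u i) = 0 →
      ∀ y, ‖y - ∑ i, mixWeights (fun i => δ ^ 2 * a i) i •
          S.F (ξ₀ + δ • ζ + δ ^ 2 • ζ', x₀ + δ • h + δ ^ 2 • h',
            (Fin.cons (u₀ + δ • v) u : Fin (k + 1) → Z) i)‖ ≤ δ ^ 3 → ‖y‖ ≤ η * δ ^ 2 := by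
  -- The factor `1 + 2kR` counts the Taylor remainder and two sums of weighted errors; the other
  -- half of `η` is left for the mixing error `δ³`.
  obtain ⟨η₁, hη₁, hη₁'⟩ : ∃ η₁ : ℝ, 0 < η₁ ∧ η₁ * (1 + 2 * (k * |R|)) ≤ η / 2 := by
    refine ⟨η / 2 / (1 + 2 * (k * |R|)), by positivity, ?_⟩
    rw [div_mul_cancel₀ _ (by positivity)]
  have h1 : ∀ᶠ p : EuclideanSpace ℝ (Fin n) × X × Z in 𝓝 (ξ₀, x₀, u₀), ‖S.F p‖ < η₁ := by
    have := hF.continuousAt.norm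
    exact this.eventually_lt_const (by simpa [hF0] using hη₁)
  have h2 : ∀ᶠ p : EuclideanSpace ℝ (Fin n) × X in 𝓝 (ξ₀, x₀),
      ∀ i, ‖S.F (p.1, p.2, u i) - S.F (ξ₀, x₀, u i)‖ < η₁ := by
    rw [Filter.eventually_all]
    intro i
    have hcont : ContinuousOn (fun p : EuclideanSpace ℝ (Fin n) × X => S.F (p.1, p.2, u i)) V :=
      hreg.1.comp (by fun_prop) fun p hp => ⟨hp, hu i⟩
    exact ((hcont.continuousAt hV).sub continuousAt_const).norm.eventually_lt_const
      (by simpa using hη₁)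
  filter_upwards [self_mem_nhdsWithin, eventually_mul_lt 1 (show 0 < η / 2 by positivity),
    h1.parabola (ζ, h, v) R, h2.parabola (ζ, h) R,
    hF.eventually_norm_parabola_le (ζ, h, v) R hη₁] with
    δ h0 hδ hs1 hs2 hs3 ζ' h' hζ' hh' a ha haR heq y hy
  have h0 : 0 < δ := h0
  have hR : 0 ≤ R := (norm_nonneg _).trans hζ'
  rw [abs_of_nonneg hR] at hη₁'
  have hw3 : ‖((ζ', h', 0) : EuclideanSpace ℝ (Fin n) × X × Z)‖ ≤ R := by
    simp [Prod.norm_def, hζ', hh']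
  have hpt : ((ξ₀, x₀, u₀) : EuclideanSpace ℝ (Fin n) × X × Z) + δ • (ζ, h, v) +
      δ ^ 2 • (ζ', h', 0) =
      (ξ₀ + δ • ζ + δ ^ 2 • ζ', x₀ + δ • h + δ ^ 2 • h', u₀ + δ • v) := by simp
  have hpt2 : ((ξ₀, x₀) : EuclideanSpace ℝ (Fin n) × X) + δ • (ζ, h) + δ ^ 2 • (ζ', h') =
      (ξ₀ + δ • ζ + δ ^ 2 • ζ', x₀ + δ • h + δ ^ 2 • h') := by simp
  have b0 := hs1 _ hw3
  have bT := hs3 _ hw3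
  have bi := hs2 (ζ', h') (by simp [Prod.norm_def, hζ', hh'])
  rw [hpt] at b0 bT
  simp only [hpt2] at bi
  rw [hF0, hq, smul_zero, add_zero, zero_add] at bT
  rw [sum_mixWeights_smul _ (fun u => S.F (ξ₀ + δ • ζ + δ ^ 2 • ζ', x₀ + δ • h + δ ^ 2 • h', u))]
    at hy
  set ξ := ξ₀ + δ • ζ + δ ^ 2 • ζ'
  set x := x₀ + δ • h + δ ^ 2 • h'
  set τ := fderiv ℝ S.F (ξ₀, x₀, u₀) (ζ', h', 0) + (1 / 2 : ℝ) •
        fderiv ℝ (fderiv ℝ S.F) (ξ₀, x₀, u₀) (ζ, h, v) (ζ, h, v)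
  have hsum : ∑ i, a i ≤ k * R := by
    have := Finset.sum_le_sum fun i (_ : i ∈ Finset.univ) => haR i
    simpa using this
  have hsum0 : 0 ≤ ∑ i, a i := Finset.sum_nonneg fun i _ => ha i
  -- The second-order equation makes `δ²τ` cancel the main contribution `δ² ∑ aᵢ F(ξ₀, x₀, uᵢ)` of
  -- the fixed controls.
  have hdecomp : y = (y - ((1 - ∑ i, δ ^ 2 * a i) • S.F (ξ, x, u₀ + δ • v) +
      ∑ i, (δ ^ 2 * a i) • S.F (ξ, x, u i))) + (S.F (ξ, x, u₀ + δ • v) - δ ^ 2 • τ) -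
      (δ ^ 2 * ∑ i, a i) • S.F (ξ, x, u₀ + δ • v) +
      δ ^ 2 • ∑ i, a i • (S.F (ξ, x, u i) - S.F (ξ₀, x₀, u i)) := by
    have hτ : τ = -∑ i, a i • S.F (ξ₀, x₀, u i) := eq_neg_of_add_eq_zero_left heq
    rw [hτ]
    simp only [smul_sub, Finset.sum_sub_distrib, ← Finset.mul_sum, mul_smul, ← Finset.smul_sum]
    module
  have e1 : ‖(δ ^ 2 * ∑ i, a i) • S.F (ξ, x, u₀ + δ • v)‖ ≤ δ ^ 2 * (k * R) * η₁ := by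
    rw [norm_smul, Real.norm_eq_abs, abs_of_nonneg (by positivity)]
    gcongr
  have e2 : ‖δ ^ 2 • ∑ i, a i • (S.F (ξ, x, u i) - S.F (ξ₀, x₀, u i))‖ ≤ δ ^ 2 * (k * R) * η₁ := by
    rw [norm_smul, Real.norm_eq_abs, abs_of_nonneg (by positivity), mul_assoc]
    gcongr
    refine (norm_sum_le _ _).trans ?_
    calc ∑ i, ‖a i • (S.F (ξ, x, u i) - S.F (ξ₀, x₀, u i))‖ ≤ ∑ i, a i * η₁ := by
          refine Finset.sum_le_sum fun i _ => ?_
          rw [norm_smul, Real.norm_eq_abs, abs_of_nonneg (ha i)]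
          exact mul_le_mul_of_nonneg_left (bi i).le (ha i)
      _ = (∑ i, a i) * η₁ := by rw [Finset.sum_mul]
      _ ≤ k * R * η₁ := by gcongr
  rw [hdecomp]
  have e3 : δ ^ 3 ≤ η / 2 * δ ^ 2 := by nlinarith [sq_nonneg δ]
  have e4 : η₁ * (1 + 2 * (k * R)) * δ ^ 2 ≤ η / 2 * δ ^ 2 := by gcongr
  refine (norm_add_le _ _).trans ?_
  refine (add_le_add_left ((norm_sub_le _ _).trans (add_le_add_left (norm_add_le _ _) _)) _).trans ?_
  linarith

end ControlSystem

namespace ControlSystem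

variable {n m₁ m₂ : ℕ} {X Y Z : Type*}
  [NormedAddCommGroup X] [NormedSpace ℝ X]
  [NormedAddCommGroup Y] [NormedSpace ℝ Y]
  [NormedAddCommGroup Z] [NormedSpace ℝ Z]
  (S : ControlSystem n m₁ m₂ X Y Z)

theorem smul_mem_mixSimplex {k : ℕ} {R δ : ℝ} (h0 : 0 < δ) (hδ1 : δ < 1) (hδ : δ * (k * R) < 1)
    {a : Fin k → ℝ} (ha : ∀ i, 0 ≤ a i) (haR : ∀ i, a i ≤ R) :
    (fun i => δ ^ 2 * a i) ∈ mixSimplex k := by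
  refine ⟨fun i => by have := ha i; positivity, ?_⟩
  have hsum : ∑ i, a i ≤ k * R := by
    have := Finset.sum_le_sum fun i (_ : i ∈ Finset.univ) => haR i
    simpa using this
  have hsum0 : 0 ≤ ∑ i, a i := Finset.sum_nonneg fun i _ => ha i
  rw [← Finset.mul_sum]
  have : δ ^ 2 * ∑ i, a i ≤ δ * (k * R) := mul_le_mul (by nlinarith) hsum hsum0 h0.le
  linarith

/-- The state equation is solvable along the parabolas `ξ₀ + δ ζ + δ² ζ'(z)`, with controls mixed
from `u₀ + δ v` and fixed controls; the state depends continuously on `z` and has a second-order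
expansion. -/
theorem exists_continuousOn_state [CompleteSpace X]
    {ξ₀ : EuclideanSpace ℝ (Fin n)} {x₀ : X} {u₀ : Z}
    (hu₀ : u₀ ∈ interior S.controls)
    (hF : ContDiffAt ℝ 2 S.F (ξ₀, x₀, u₀)) (hF0 : S.F (ξ₀, x₀, u₀) = 0)
    (A : X ≃L[ℝ] Y) (hA : (A : X →L[ℝ] Y) = S.Fx ξ₀ x₀ u₀)
    {V : Set (EuclideanSpace ℝ (Fin n) × X)} (hV : V ∈ 𝓝 (ξ₀, x₀)) (hreg : S.IsRegularOn V)
    (hmix : S.HasMixesOn V) {k : ℕ} (hk : 1 ≤ k) (u : Fin k → Z) (hu : ∀ i, u i ∈ S.controls)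
    {ζ : EuclideanSpace ℝ (Fin n)} {h : X} {v : Z}
    (hq : fderiv ℝ S.F (ξ₀, x₀, u₀) (ζ, h, v) = 0)
    {E : Type*} [TopologicalSpace E] {B : Set E} {ζ' : E → EuclideanSpace ℝ (Fin n)} {h' : E → X}
    {a : Fin k → E → ℝ} (hζ'c : ContinuousOn ζ' B)
    (hac : ∀ i, ContinuousOn (a i) B) {R : ℝ} (hζ' : ∀ z ∈ B, ‖ζ' z‖ ≤ R)
    (hh' : ∀ z ∈ B, ‖h' z‖ ≤ R) (ha : ∀ z ∈ B, ∀ i, 0 ≤ a i z) (haR : ∀ z ∈ B, ∀ i, a i z ≤ R)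
    (heq : ∀ z ∈ B, fderiv ℝ S.F (ξ₀, x₀, u₀) (ζ' z, h' z, 0) + (1 / 2 : ℝ) •
        fderiv ℝ (fderiv ℝ S.F) (ξ₀, x₀, u₀) (ζ, h, v) (ζ, h, v) +
        ∑ i, a i z • S.F (ξ₀, x₀, u i) = 0) {ε : ℝ} (hε : 0 < ε) :
    ∀ᶠ δ : ℝ in 𝓝[>] 0, ∃ (x : E → X) (c : E → Z), ContinuousOn x B ∧ ∀ z ∈ B,
      c z ∈ S.controls ∧ S.F (ξ₀ + δ • ζ + δ ^ 2 • ζ' z, x z, c z) = 0 ∧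
        ‖x z - (x₀ + δ • h + δ ^ 2 • h' z)‖ ≤ ε * δ ^ 2 := by
  set N := ‖(A.symm : Y →L[ℝ] X)‖ with hN
  obtain ⟨c₀, hc₀, hNc⟩ : ∃ c₀ : NNReal, 0 < c₀ ∧ N * c₀ ≤ 1 / 2 := by
    have hpos : 0 < 1 / (2 * (N + 1)) := by positivity
    refine ⟨Real.toNNReal (1 / (2 * (N + 1))), Real.toNNReal_pos.mpr hpos, ?_⟩
    rw [Real.coe_toNNReal _ hpos.le, mul_one_div, div_le_div_iff₀ (by positivity) (by positivity)]
    linarith [norm_nonneg (A.symm : Y →L[ℝ] X)]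
  obtain ⟨r, hr, hrV, hder⟩ := S.exists_eventually_norm_mix_Fx_sub_le hF hV hreg u hu v R
    (NNReal.coe_pos.mpr hc₀)
  obtain ⟨η, hη, hηε⟩ : ∃ η : ℝ, 0 < η ∧ 2 * N * η ≤ ε := by
    refine ⟨ε / (2 * N + 1), by positivity, ?_⟩
    rw [mul_div_assoc', div_le_iff₀ (by positivity)]
    nlinarith
  have hres := S.eventually_norm_mix_le hF hF0 hV hreg u hu hq R hη
  have hball : ∀ᶠ p : EuclideanSpace ℝ (Fin n) × X in 𝓝 (ξ₀, x₀),
      p ∈ Metric.closedBall (ξ₀, x₀) (r / 2) := Metric.closedBall_mem_nhds _ (by positivity)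
  have hctrl : ∀ᶠ w in 𝓝 u₀, w ∈ S.controls := mem_interior_iff_mem_nhds.mp hu₀
  filter_upwards [hder, hres, hball.parabola (ζ, h) R, hctrl.parabola v 0, self_mem_nhdsWithin,
    eventually_mul_lt 1 one_pos, eventually_mul_lt (k * R) one_pos,
    eventually_mul_lt ε (show 0 < r / 2 by positivity)] with δ hder hres hball hctrl h0 hδ1 hδR hδε
  have h0 : 0 < δ := h0
  have hδ2 : δ ^ 2 ≤ δ := by nlinarith
  have hv : u₀ + δ • v ∈ S.controls := by simpa using hctrl 0 (by simp)
  set ū : Fin (k + 1) → Z := Fin.cons (u₀ + δ • v) u with hū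
  have hūc : ∀ i, ū i ∈ S.controls := by
    intro i
    refine Fin.cases ?_ (fun j => ?_) i
    · simpa [hū] using hv
    · simpa [hū] using hu j
  -- Mixing accuracy `δ³` is `o(δ²)`, for both `F` and `F_x`. One map `M` serves all `z`, which
  -- enters only through the weights.
  obtain ⟨M, hM, hMapp⟩ := hmix k hk (δ ^ 3) (by positivity)
  obtain ⟨hMc, hMcont⟩ := hM ū hūc
  have hMest : ∀ ξ x, (ξ, x) ∈ V → ∀ α ∈ mixSimplex k,
      ‖S.F (ξ, x, M α ū) - ∑ i, mixWeights α i • S.F (ξ, x, ū i)‖ ≤ δ ^ 3 ∧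
      ‖S.Fx ξ x (M α ū) - ∑ i, mixWeights α i • S.Fx ξ x (ū i)‖ ≤ δ ^ 3 := by
    intro ξ x hξx α hα
    obtain ⟨U, hU, hUest⟩ := hMapp ξ x hξx ū hūc
    have := hUest ξ x ū (mem_of_mem_nhds hU) hūc α hα
    exact ⟨this.1.le, this.2.le⟩
  set α : E → Fin k → ℝ := fun z i => δ ^ 2 * a i z with hα
  have hαmem : ∀ z ∈ B, α z ∈ mixSimplex k := fun z hz =>
    smul_mem_mixSimplex h0 (by linarith) hδR (ha z hz) (haR z hz)
  have hαc : ContinuousOn α B := continuousOn_pi.mpr fun i => continuousOn_const.mul (hac i)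
  set ξ : E → EuclideanSpace ℝ (Fin n) := fun z => ξ₀ + δ • ζ + δ ^ 2 • ζ' z with hξ
  set xt : E → X := fun z => x₀ + δ • h + δ ^ 2 • h' z with hxt
  set ctl : E → Z := fun z => M (α z) ū with hctl
  have hctlmem : ∀ z ∈ B, ctl z ∈ S.controls := fun z hz => hMc _ (hαmem z hz)
  have hctlc : ContinuousOn ctl B := hMcont.comp hαc hαmem
  have hξc : ContinuousOn ξ B := by fun_prop
  have hnear : ∀ z ∈ B, ξ z ∈ Metric.closedBall ξ₀ (r / 2) ∧ xt z ∈ Metric.closedBall x₀ (r / 2) := by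
    intro z hz
    have := hball (ζ' z, h' z) (by simp [Prod.norm_def, hζ' z hz, hh' z hz])
    rw [← closedBall_prod_same] at this
    exact this
  have hξr : ∀ z ∈ B, ∀ x ∈ Metric.closedBall x₀ r, (ξ z, x) ∈ Metric.closedBall (ξ₀, x₀) r := by
    intro z hz x hx
    rw [← closedBall_prod_same]
    exact ⟨Metric.closedBall_subset_closedBall (by linarith) (hnear z hz).1, hx⟩
  -- With the control frozen at `ctl z`, the state equation is close to `A` on a ball independent of
  -- `z` and `δ`.
  have happ : ∀ z ∈ B, ApproximatesLinearOn (fun x => S.F (ξ z, x, ctl z)) (A : X →L[ℝ] Y)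
      (Metric.closedBall x₀ r) c₀ := by
    intro z hz
    refine approximatesLinearOn_of_norm_fderiv_sub_le (convex_closedBall _ _) (fun x hx => ?_)
      fun x hx => ?_
    · exact (hreg.2 (ctl z) (hctlmem z hz)).1 _ (hrV (hξr z hz x hx))
    · rw [hA]
      exact hder (ξ z) x (hξr z hz x hx) (fun i => a i z) (ha z hz) (haR z hz) _
        (hMest _ _ (hrV (hξr z hz x hx)) _ (hαmem z hz)).2
  have hsmall : ∀ z ∈ B, 2 * N * ‖S.F (ξ z, xt z, ctl z)‖ ≤ ε * δ ^ 2 := by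
    intro z hz
    have hmemV : (ξ z, xt z) ∈ V := hrV (hξr z hz _
      (Metric.closedBall_subset_closedBall (by linarith) (hnear z hz).2))
    have := hres (ζ' z) (h' z) (hζ' z hz) (hh' z hz) (fun i => a i z) (ha z hz) (haR z hz)
      (heq z hz) _ (hMest _ _ hmemV _ (hαmem z hz)).1
    calc 2 * N * ‖S.F (ξ z, xt z, ctl z)‖ ≤ 2 * N * (η * δ ^ 2) := by gcongr
      _ = 2 * N * η * δ ^ 2 := by ring
      _ ≤ ε * δ ^ 2 := by gcongr
  have hεr : ε * δ ^ 2 ≤ r / 2 := by nlinarith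
  have hsub : ∀ z ∈ B, Metric.closedBall (xt z) (2 * N * ‖S.F (ξ z, xt z, ctl z)‖) ⊆
      Metric.closedBall x₀ r := by
    intro z hz
    refine Metric.closedBall_subset_closedBall' ?_
    have h1 := hsmall z hz
    have h2 := Metric.mem_closedBall.mp (hnear z hz).2
    linarith
  have hsol : ∀ z, ∃ x, z ∈ B → x ∈ Metric.closedBall (xt z) (2 * N * ‖S.F (ξ z, xt z, ctl z)‖) ∧
      S.F (ξ z, x, ctl z) = 0 := by
    intro z
    by_cases hz : z ∈ B
    · obtain ⟨x, hx⟩ := (happ z hz).exists_eq_zero hNc (hsub z hz)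
      exact ⟨x, fun _ => hx⟩
    · exact ⟨0, fun h => absurd h hz⟩
  choose x hx using hsol
  refine ⟨x, ctl, fun z₀ hz₀ => ?_, fun z hz => ⟨hctlmem z hz, (hx z hz).2, ?_⟩⟩
  -- The states were picked by choice; continuity follows from `‖x z - x z₀‖ ≤ 2N ‖F(ξ z, x z₀, ctl
  -- z)‖`, whose right side tends to `0`.
  · have hxr : ∀ z ∈ B, x z ∈ Metric.closedBall x₀ r := fun z hz => hsub z hz (hx z hz).1
    have hcont : ContinuousOn (fun z => ‖S.F (ξ z, x z₀, ctl z)‖) B :=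
      (hreg.1.comp (hξc.prodMk (continuousOn_const.prodMk hctlc)) fun z hz =>
        ⟨hrV (hξr z hz _ (hxr z₀ hz₀)), hctlmem z hz⟩).norm
    have hlim : Filter.Tendsto (fun z => 2 * N * ‖S.F (ξ z, x z₀, ctl z)‖) (𝓝[B] z₀)
        (𝓝 (2 * N * ‖S.F (ξ z₀, x z₀, ctl z₀)‖)) := (hcont z₀ hz₀).const_mul (2 * N)
    rw [(hx z₀ hz₀).2, norm_zero, mul_zero] at hlim
    rw [ContinuousWithinAt, tendsto_iff_norm_sub_tendsto_zero]
    refine squeeze_zero' (Filter.Eventually.of_forall fun z => norm_nonneg _) ?_ hlim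
    filter_upwards [self_mem_nhdsWithin] with z hz
    have := (happ z hz).norm_sub_le_two_mul hNc (hxr z hz) (hxr z₀ hz₀)
    simpa [(hx z hz).2] using this
  · rw [← mem_closedBall_iff_norm]
    exact Metric.closedBall_subset_closedBall (hsmall z hz) (hx z hz).1

end ControlSystem

/-! ### From the second-order system to the perturbed system -/

/-- The second-order expansion along parabolas when the second component is only known up to an
error `o(δ²)`. -/
theorem ContDiffAt.exists_eventually_norm_parabola_le {E X G : Type*} [NormedAddCommGroup E]
    [NormedSpace ℝ E] [NormedAddCommGroup X] [NormedSpace ℝ X] [NormedAddCommGroup G]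
    [NormedSpace ℝ G] {Φ : E × X → G} {ξ₀ : E} {x₀ : X} (hΦ : ContDiffAt ℝ 2 Φ (ξ₀, x₀))
    (ζ : E) (h : X) (R : ℝ) {η : ℝ} (hη : 0 < η) :
    ∃ ε₀ > 0, ∀ ε, ε ≤ ε₀ → ∀ᶠ δ : ℝ in 𝓝[>] 0, ∀ ζ' h' x, ‖ζ'‖ ≤ R → ‖h'‖ ≤ R →
      ‖x - (x₀ + δ • h + δ ^ 2 • h')‖ ≤ ε * δ ^ 2 →
        ContinuousAt Φ (ξ₀ + δ • ζ + δ ^ 2 • ζ', x) ∧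
        ‖Φ (ξ₀ + δ • ζ + δ ^ 2 • ζ', x) - (Φ (ξ₀, x₀) + δ • fderiv ℝ Φ (ξ₀, x₀) (ζ, h) +
          δ ^ 2 • (fderiv ℝ Φ (ξ₀, x₀) (ζ', h') +
            (1 / 2 : ℝ) • fderiv ℝ (fderiv ℝ Φ) (ξ₀, x₀) (ζ, h) (ζ, h)))‖ ≤ η * δ ^ 2 := by
  set D := fderiv ℝ Φ (ξ₀, x₀)
  obtain ⟨ε₀, hε₀, hε₀1, hDε⟩ : ∃ ε₀ : ℝ, 0 < ε₀ ∧ ε₀ ≤ 1 ∧ ‖D‖ * ε₀ ≤ η / 2 := by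
    refine ⟨min 1 (η / 2 / (‖D‖ + 1)), by positivity, min_le_left _ _, ?_⟩
    calc ‖D‖ * min 1 (η / 2 / (‖D‖ + 1)) ≤ (‖D‖ + 1) * (η / 2 / (‖D‖ + 1)) := by
          gcongr
          · linarith
          · exact min_le_right _ _
      _ = η / 2 := mul_div_cancel₀ _ (by positivity)
  refine ⟨ε₀, hε₀, fun ε hε => ?_⟩
  have hcont : ∀ᶠ p in 𝓝 (ξ₀, x₀), ContinuousAt Φ p :=
    (hΦ.eventually (by simp)).mono fun p hp => hp.continuousAt
  filter_upwards [hcont.parabola (ζ, h) (R + 1), self_mem_nhdsWithin,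
    hΦ.eventually_norm_parabola_le (ζ, h) (R + 1) (half_pos hη)] with
    δ hcont h0 hT ζ' h' x hζ' hh' hx
  have h0 : 0 < δ := h0
  -- The error in the state is absorbed into the second-order coefficient, so that `x` lies exactly
  -- on a parabola.
  obtain ⟨h'', hh''⟩ : ∃ h'' : X, h'' = h' + (δ ^ 2)⁻¹ • (x - (x₀ + δ • h + δ ^ 2 • h')) := ⟨_, rfl⟩
  have hxe : x = x₀ + δ • h + δ ^ 2 • h'' := by
    rw [hh'', smul_add, smul_smul, mul_inv_cancel₀ (by positivity), one_smul]
    abel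
  have hdiff : ‖h'' - h'‖ ≤ ε₀ := by
    rw [hh'', add_sub_cancel_left, norm_smul, norm_inv, Real.norm_eq_abs,
      abs_of_pos (by positivity), inv_mul_le_iff₀ (by positivity)]
    calc _ ≤ ε * δ ^ 2 := hx
      _ ≤ δ ^ 2 * ε₀ := by rw [mul_comm]; gcongr
  have hh''R : ‖h''‖ ≤ R + 1 := by
    have := norm_le_norm_add_norm_sub' h'' h'
    linarith
  have hw : ‖((ζ', h'') : E × X)‖ ≤ R + 1 := by
    simp only [Prod.norm_def, max_le_iff]
    exact ⟨by linarith, hh''R⟩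
  have hpt : ((ξ₀, x₀) : E × X) + δ • (ζ, h) + δ ^ 2 • (ζ', h'') =
      (ξ₀ + δ • ζ + δ ^ 2 • ζ', x) := by simp [hxe]
  have h1 := hcont _ hw
  have h2 := hT _ hw
  rw [hpt] at h1 h2
  refine ⟨h1, ?_⟩
  have h3 : ‖D (ζ', h'') - D (ζ', h')‖ ≤ η / 2 := by
    rw [← map_sub]
    refine (D.le_opNorm _).trans (le_trans ?_ hDε)
    gcongr
    simp [Prod.norm_def, hdiff]
  set τ := (1 / 2 : ℝ) • fderiv ℝ (fderiv ℝ Φ) (ξ₀, x₀) (ζ, h) (ζ, h)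
  have heq : Φ (ξ₀ + δ • ζ + δ ^ 2 • ζ', x) -
      (Φ (ξ₀, x₀) + δ • D (ζ, h) + δ ^ 2 • (D (ζ', h') + τ)) =
      (Φ (ξ₀ + δ • ζ + δ ^ 2 • ζ', x) -
        (Φ (ξ₀, x₀) + δ • D (ζ, h) + δ ^ 2 • (D (ζ', h'') + τ))) +
      δ ^ 2 • (D (ζ', h'') - D (ζ', h')) := by module
  rw [heq]
  have h4 : ‖δ ^ 2 • (D (ζ', h'') - D (ζ', h'))‖ ≤ δ ^ 2 * (η / 2) := by
    rw [norm_smul, Real.norm_eq_abs, abs_of_pos (by positivity)]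
    gcongr
  refine (norm_add_le _ _).trans ?_
  linarith

theorem fderiv_partial_fst {E X G : Type*} [NormedAddCommGroup E]
    [NormedSpace ℝ E] [NormedAddCommGroup X] [NormedSpace ℝ X] [NormedAddCommGroup G]
    [NormedSpace ℝ G] {Φ : E × X → G} {ξ₀ : E} {x₀ : X} (h : DifferentiableAt ℝ Φ (ξ₀, x₀)) (ζ : E) :
    fderiv ℝ (fun ξ => Φ (ξ, x₀)) ξ₀ ζ = fderiv ℝ Φ (ξ₀, x₀) (ζ, 0) := by
  have h1 : HasFDerivAt (fun ξ : E => ((ξ, x₀) : E × X)) _ ξ₀ :=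
    (hasFDerivAt_id (𝕜 := ℝ) ξ₀).prodMk (hasFDerivAt_const x₀ ξ₀)
  exact congrArg (fun T : E →L[ℝ] G => T ζ) (h.hasFDerivAt.comp ξ₀ h1).fderiv

theorem fderiv_partial_snd {E X G : Type*} [NormedAddCommGroup E]
    [NormedSpace ℝ E] [NormedAddCommGroup X] [NormedSpace ℝ X] [NormedAddCommGroup G]
    [NormedSpace ℝ G] {Φ : E × X → G} {ξ₀ : E} {x₀ : X} (h : DifferentiableAt ℝ Φ (ξ₀, x₀)) (v : X) :
    fderiv ℝ (fun x => Φ (ξ₀, x)) x₀ v = fderiv ℝ Φ (ξ₀, x₀) (0, v) := by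
  have h1 : HasFDerivAt (fun x : X => ((ξ₀, x) : E × X)) _ x₀ :=
    (hasFDerivAt_const (𝕜 := ℝ) ξ₀ x₀).prodMk (hasFDerivAt_id x₀)
  exact congrArg (fun T : X →L[ℝ] G => T v) (h.hasFDerivAt.comp x₀ h1).fderiv

/-- Supplies the slack `μ` that absorbs the expansion error in every inequality at once. The
denominator `‖o‖ + 1` keeps `μ` positive and defined also for `m = 0`. -/
theorem exists_constant_vector (m : ℕ) {ρ : ℝ} (hρ : 0 < ρ) :
    ∃ (e : EuclideanSpace ℝ (Fin m)) (μ : ℝ), 0 < μ ∧ (∀ i, e i = μ) ∧ ‖e‖ ≤ ρ := by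
  obtain ⟨o, ho⟩ : ∃ o : EuclideanSpace ℝ (Fin m), ∀ i, o i = 1 := ⟨WithLp.toLp 2 1, fun i => rfl⟩
  have hpos : 0 < ρ / (‖o‖ + 1) := by positivity
  refine ⟨(ρ / (‖o‖ + 1)) • o, _, hpos, fun i => by simp [ho], ?_⟩
  rw [norm_smul, Real.norm_eq_abs, abs_of_pos hpos, div_mul_eq_mul_div,
    div_le_iff₀ (by positivity)]
  exact mul_le_mul_of_nonneg_left (by linarith) (by positivity)

/-- A perturbed system of inequalities and equations is solvable when its left-hand sides are
uniformly close to a multiple of the identity. -/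
theorem exists_le_and_eq_of_norm_sub_le {m₁ m₂ : ℕ} {ρ μ t : ℝ} (hρ : 0 < ρ) (ht : 0 < t)
    {e : EuclideanSpace ℝ (Fin m₁)} (heμ : ∀ i, e i = μ) (he : ‖e‖ ≤ ρ / 4)
    {φ : EuclideanSpace ℝ (Fin m₁) × EuclideanSpace ℝ (Fin m₂) → EuclideanSpace ℝ (Fin m₁)}
    {γ : EuclideanSpace ℝ (Fin m₁) × EuclideanSpace ℝ (Fin m₂) → EuclideanSpace ℝ (Fin m₂)}
    (hφ : ∀ z ∈ Metric.closedBall 0 ρ, ∀ i, φ z i ≤ t * (z.1 i + μ))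
    (hγc : ContinuousOn γ (Metric.closedBall 0 ρ))
    (hγ : ∀ z ∈ Metric.closedBall 0 ρ, ‖γ z - t • z.2‖ ≤ ρ / 4 * t)
    {y₁ : EuclideanSpace ℝ (Fin m₁)} {y₂ : EuclideanSpace ℝ (Fin m₂)}
    (hy₁ : ‖y₁‖ ≤ ρ / 4 * t) (hy₂ : ‖y₂‖ ≤ ρ / 4 * t) :
    ∃ z ∈ Metric.closedBall 0 ρ, (∀ i, φ z i ≤ y₁ i) ∧ γ z = y₂ := by
  -- Chosen so that `t (z₁ + μ) = y₁` in each coordinate: the inequalities hold for every `z₂`, and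
  -- the fixed point argument concerns `z₂` only.
  obtain ⟨z₁, hz₁⟩ : ∃ z₁, z₁ = t⁻¹ • y₁ - e := ⟨_, rfl⟩
  have hz₁n : ‖z₁‖ ≤ ρ := by
    rw [hz₁]
    refine (norm_sub_le _ _).trans ?_
    rw [norm_smul, norm_inv, Real.norm_eq_abs, abs_of_pos ht]
    have : t⁻¹ * ‖y₁‖ ≤ ρ / 4 := by
      rw [inv_mul_le_iff₀ ht]; linarith
    linarith
  have hslice : ∀ z₂ ∈ Metric.closedBall (0 : EuclideanSpace ℝ (Fin m₂)) ρ,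
      (z₁, z₂) ∈ Metric.closedBall (0 : EuclideanSpace ℝ (Fin m₁) × EuclideanSpace ℝ (Fin m₂)) ρ := by
    intro z₂ hz₂
    rw [mem_closedBall_zero_iff] at hz₂ ⊢
    rw [Prod.norm_def]
    exact max_le hz₁n hz₂
  have hγ' : ContinuousOn (fun z₂ => γ (z₁, z₂))
      (Metric.closedBall (0 : EuclideanSpace ℝ (Fin m₂)) ρ) :=
    hγc.comp (f := fun z₂ => (z₁, z₂)) (continuousOn_const.prodMk continuousOn_id) hslice
  have hc : ContinuousOn (fun z₂ => t⁻¹ • γ (z₁, z₂))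
      (Metric.closedBall (0 : EuclideanSpace ℝ (Fin m₂)) ρ) := hγ'.fun_const_smul t⁻¹
  obtain ⟨z₂, hz₂, hgz⟩ := exists_eq_of_norm_sub_id_le (a := ρ / 4) (b := ρ / 4)
    (w := t⁻¹ • y₂) hρ (by linarith) hc (by
      intro z₂ hz₂
      have h1 := hγ _ (hslice z₂ hz₂)
      have h2 : t⁻¹ • γ (z₁, z₂) - z₂ = t⁻¹ • (γ (z₁, z₂) - t • z₂) := by
        rw [smul_sub, smul_smul, inv_mul_cancel₀ ht.ne', one_smul]
      rw [h2, norm_smul, norm_inv, Real.norm_eq_abs, abs_of_pos ht, inv_mul_le_iff₀ ht]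
      linarith) (by
      rw [norm_smul, norm_inv, Real.norm_eq_abs, abs_of_pos ht, inv_mul_le_iff₀ ht]
      linarith)
  refine ⟨(z₁, z₂), hslice z₂ hz₂, fun i => ?_, smul_right_injective _ (inv_ne_zero ht.ne') hgz⟩
  refine (hφ _ (hslice z₂ hz₂) i).trans (le_of_eq ?_)
  simp [hz₁, heμ, mul_inv_cancel_left₀ ht.ne']

/-- Since `δ² s ≤ 1` and `f₀ ≤ 0`, the term `δ² s f₀` is paid for by `f₀` itself. Thus inactive
constraints impose nothing at second order once `s` is large, while `δ d ≤ 0` can be dropped. -/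
theorem apply_le_of_norm_sub_le {m : ℕ} {φ f₀ d b z : EuclideanSpace ℝ (Fin m)} {δ s μ : ℝ}
    (h0 : 0 < δ) (hs : δ ^ 2 * s ≤ 1) (hf₀ : ∀ i, f₀ i ≤ 0) (hd : ∀ i, d i ≤ 0)
    (hb : ∀ i, (b + s • f₀) i ≤ z i) (hφ : ‖φ - (f₀ + δ • d + δ ^ 2 • b)‖ ≤ μ * δ ^ 2) (i : Fin m) :
    φ i ≤ δ ^ 2 * (z i + μ) := by
  have h2 := (le_abs_self _).trans ((PiLp.norm_apply_le _ i).trans hφ)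
  have h3 := hb i
  simp only [WithLp.ofLp_sub, WithLp.ofLp_add, WithLp.ofLp_smul, Pi.sub_apply, Pi.add_apply,
    Pi.smul_apply, smul_eq_mul] at h2 h3
  have h9 := mul_le_mul_of_nonneg_left h3 (sq_nonneg δ)
  have h10 := mul_nonpos_of_nonneg_of_nonpos h0.le (hd i)
  have h11 := mul_nonpos_of_nonneg_of_nonpos (sub_nonneg.mpr hs) (hf₀ i)
  linarith

/-- The distance to the base point along a parabola. -/
theorem norm_sub_le_of_parabola {E : Type*} [NormedAddCommGroup E] [NormedSpace ℝ E]
    {x x₀ h h' : E} {δ ε R : ℝ} (h0 : 0 < δ) (hδ1 : δ ≤ 1) (hε : ε ≤ 1) (hh' : ‖h'‖ ≤ R)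
    (hx : ‖x - (x₀ + δ • h + δ ^ 2 • h')‖ ≤ ε * δ ^ 2) : ‖x - x₀‖ ≤ (‖h‖ + R + 1) * δ := by
  have hδ2 : δ ^ 2 ≤ δ := by nlinarith
  have e1 : x - x₀ = (x - (x₀ + δ • h + δ ^ 2 • h')) + δ • h + δ ^ 2 • h' := by abel
  rw [e1]
  refine norm_add₃_le.trans ?_
  rw [norm_smul, norm_smul, Real.norm_eq_abs, Real.norm_eq_abs, abs_of_pos h0,
    abs_of_pos (by positivity)]
  have e2 : δ ^ 2 * ‖h'‖ ≤ δ * R := mul_le_mul hδ2 hh' (norm_nonneg _) h0.le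
  have e3 : ε * δ ^ 2 ≤ 1 * δ := mul_le_mul hε hδ2 (by positivity) zero_le_one
  linarith

namespace ControlSystem

variable {n m₁ m₂ : ℕ} {X Y Z : Type*}
  [NormedAddCommGroup X] [NormedSpace ℝ X]
  [NormedAddCommGroup Y] [NormedSpace ℝ Y]
  [NormedAddCommGroup Z] [NormedSpace ℝ Z]
  (S : ControlSystem n m₁ m₂ X Y Z)

/-- In the absence of second-order multipliers, the convexified second-order system is solvable for
all small right-hand sides, continuously and with finitely many controls. -/
theorem exists_continuous_second_order_solution
    {ξ₀ : EuclideanSpace ℝ (Fin n)} {x₀ : X} {u₀ : Z} (hadm : S.IsAdmissible ξ₀ x₀ u₀)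
    (hF : ContDiffAt ℝ 2 S.F (ξ₀, x₀, u₀)) (hf : ContDiffAt ℝ 2 S.f (ξ₀, x₀))
    (hg : ContDiffAt ℝ 2 S.g (ξ₀, x₀)) (A : X ≃L[ℝ] Y) (hA : (A : X →L[ℝ] Y) = S.Fx ξ₀ x₀ u₀)
    {ζ : EuclideanSpace ℝ (Fin n)} {h : X} {v : Z}
    (hΛ : S.multipliers ξ₀ x₀ u₀ (ζ, h, v) = ∅) :
    ∃ (k : ℕ) (u : Fin k → Z) (ρ : ℝ)
      (ζ' : EuclideanSpace ℝ (Fin m₁) × EuclideanSpace ℝ (Fin m₂) → EuclideanSpace ℝ (Fin n))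
      (h' : EuclideanSpace ℝ (Fin m₁) × EuclideanSpace ℝ (Fin m₂) → X)
      (a : Fin k → EuclideanSpace ℝ (Fin m₁) × EuclideanSpace ℝ (Fin m₂) → ℝ)
      (s : EuclideanSpace ℝ (Fin m₁) × EuclideanSpace ℝ (Fin m₂) → ℝ),
      1 ≤ k ∧ (∀ i, u i ∈ S.controls) ∧ 0 < ρ ∧
      Continuous ζ' ∧ Continuous h' ∧ (∀ i, Continuous (a i)) ∧ Continuous s ∧
      ∀ z, ‖z‖ ≤ ρ → (∀ i, 0 ≤ a i z) ∧ 0 ≤ s z ∧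
        fderiv ℝ S.F (ξ₀, x₀, u₀) (ζ' z, h' z, 0) + (1 / 2 : ℝ) •
          fderiv ℝ (fderiv ℝ S.F) (ξ₀, x₀, u₀) (ζ, h, v) (ζ, h, v) +
          ∑ i, a i z • S.F (ξ₀, x₀, u i) = 0 ∧
        (∀ i, (fderiv ℝ S.f (ξ₀, x₀) (ζ' z, h' z) + (1 / 2 : ℝ) •
          fderiv ℝ (fderiv ℝ S.f) (ξ₀, x₀) (ζ, h) (ζ, h) + s z • S.f (ξ₀, x₀)) i ≤ z.1 i) ∧
        fderiv ℝ S.g (ξ₀, x₀) (ζ' z, h' z) + (1 / 2 : ℝ) •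
          fderiv ℝ (fderiv ℝ S.g) (ξ₀, x₀) (ζ, h) (ζ, h) = z.2 := by
  obtain ⟨hu₀, hF0, hf₀, hg₀⟩ := hadm
  have hdF := hF.differentiableAt two_ne_zero
  have hdf := hf.differentiableAt two_ne_zero
  have hdg := hg.differentiableAt two_ne_zero
  have hA' : ∀ x, A x = S.Fx ξ₀ x₀ u₀ x := fun x => by rw [← hA]; rfl
  have : Nonempty S.controls := ⟨⟨u₀, interior_subset hu₀⟩⟩
  rcases exists_continuous_solution_or_multipliers (S.Fξ ξ₀ x₀ u₀) A
    (fun u : S.controls => S.F (ξ₀, x₀, u)) (fderiv ℝ S.f (ξ₀, x₀)) (fderiv ℝ S.g (ξ₀, x₀))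
    (S.f (ξ₀, x₀)) ((1 / 2 : ℝ) • fderiv ℝ (fderiv ℝ S.f) (ξ₀, x₀) (ζ, h) (ζ, h)) hf₀
    ((1 / 2 : ℝ) • fderiv ℝ (fderiv ℝ S.g) (ξ₀, x₀) (ζ, h) (ζ, h))
    ((1 / 2 : ℝ) • fderiv ℝ (fderiv ℝ S.F) (ξ₀, x₀, u₀) (ζ, h, v) (ζ, h, v)) with
    ⟨k, u, ρ, ζ', h', a, s, hk, hρ, hζ', hh', ha, hs, hsol⟩ |
    ⟨yst, l₁, l₂, hl₁, hl, hξ, hx, hmin, hcs, hτ⟩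
  · refine ⟨k, fun i => u i, ρ, ζ', h', a, s, hk, fun i => (u i).2, hρ, hζ', hh', ha, hs,
      fun z hz => ?_⟩
    obtain ⟨h1, h2, h3, h4, h5⟩ := hsol z hz
    refine ⟨h1, h2, ?_, h4, h5⟩
    rw [hA', S.Fξ_apply_eq hdF, S.Fx_apply_eq hdF, ← map_add] at h3
    simpa using h3
  · exfalso
    rw [Set.eq_empty_iff_forall_notMem] at hΛ
    refine hΛ (yst, l₁, l₂) ⟨yst, l₁, l₂, rfl, hl₁, hl, ?_, ?_, fun u hu => ?_, ?_, hcs, ?_⟩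
    · ext w
      have := hξ w
      rw [← fderiv_partial_fst hdf, ← fderiv_partial_fst hdg] at this
      simpa using this
    · ext w
      have := hx w
      rw [← fderiv_partial_snd hdf, ← fderiv_partial_snd hdg, hA'] at this
      simpa using this
    · change yst (S.F (ξ₀, x₀, u₀)) ≤ yst (S.F (ξ₀, x₀, u))
      rw [hF0, map_zero]
      exact hmin ⟨u, hu⟩
    · rw [hF0, map_zero]
    · simp only [map_smul, smul_eq_mul] at hτ
      linarith

/-- Solvability of the perturbed system for perturbations of order `δ²`, with solutions at distance
of order `δ`. -/
theorem exists_eventually_solvesPerturbed [CompleteSpace X]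
    {ξ₀ : EuclideanSpace ℝ (Fin n)} {x₀ : X} {u₀ : Z} (hadm : S.IsAdmissible ξ₀ x₀ u₀)
    (hbasic : S.BasicAssumptions ξ₀ x₀ u₀) {q : EuclideanSpace ℝ (Fin n) × X × Z}
    (hq : q ∈ S.criticalCone ξ₀ x₀ u₀) (hΛ : S.multipliers ξ₀ x₀ u₀ q = ∅) :
    ∃ ρ > 0, ∃ C > 0, ∀ᶠ δ : ℝ in 𝓝[>] 0, ∀ y₁ y₂, ‖y₁‖ ≤ ρ * δ ^ 2 → ‖y₂‖ ≤ ρ * δ ^ 2 →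
      ∃ ξ x u, S.SolvesPerturbed y₁ y₂ ξ x u ∧ ‖x - x₀‖ + ‖ξ - ξ₀‖ ≤ C * δ := by
  obtain ⟨ζ, h, v⟩ := q
  obtain ⟨hqF, hqf, hqg⟩ := hq
  obtain ⟨hF, hf, hg, ⟨A, hA⟩, V, hVo, hVmem, hreg, hmix⟩ := hbasic
  obtain ⟨k, u, ρ, ζ', h', a, s, hk, hu, hρ, hζ'c, hh'c, hac, hsc, hsol⟩ :=
    S.exists_continuous_second_order_solution hadm hF hf hg A hA hΛ
  obtain ⟨hu₀, hF0, hf₀, hg₀⟩ := hadm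
  set B := Metric.closedBall (0 : EuclideanSpace ℝ (Fin m₁) × EuclideanSpace ℝ (Fin m₂)) ρ with hB
  have hBc : IsCompact B := isCompact_closedBall 0 ρ
  replace hsol := fun z (hz : z ∈ B) => hsol z (mem_closedBall_zero_iff.mp hz)
  -- Compactness of the ball of right-hand sides gives one bound for all second-order data, so that
  -- every later estimate is uniform in `z`.
  obtain ⟨R, hR⟩ : ∃ R : ℝ, ∀ z ∈ B, ‖ζ' z‖ + ‖h' z‖ + ∑ i, |a i z| + |s z| ≤ R := by
    obtain ⟨R, hR⟩ := hBc.exists_bound_of_continuousOn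
      (f := fun z => ‖ζ' z‖ + ‖h' z‖ + ∑ i, |a i z| + |s z|) (by fun_prop)
    exact ⟨R, fun z hz => (le_abs_self _).trans (hR z hz)⟩
  have hsum0 : ∀ z, 0 ≤ ∑ i, |a i z| := fun z => Finset.sum_nonneg fun i _ => abs_nonneg _
  have hζ'R : ∀ z ∈ B, ‖ζ' z‖ ≤ R := fun z hz => by
    linarith [hR z hz, hsum0 z, norm_nonneg (h' z), abs_nonneg (s z)]
  have hh'R : ∀ z ∈ B, ‖h' z‖ ≤ R := fun z hz => by
    linarith [hR z hz, hsum0 z, norm_nonneg (ζ' z), abs_nonneg (s z)]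
  have haR : ∀ z ∈ B, ∀ i, a i z ≤ R := fun z hz i => by
    have := Finset.single_le_sum (f := fun i => |a i z|) (fun j _ => abs_nonneg _)
      (Finset.mem_univ i)
    linarith [hR z hz, norm_nonneg (ζ' z), norm_nonneg (h' z), abs_nonneg (s z), le_abs_self (a i z)]
  have hsR : ∀ z ∈ B, s z ≤ R := fun z hz => by
    linarith [hR z hz, hsum0 z, norm_nonneg (ζ' z), norm_nonneg (h' z), le_abs_self (s z)]
  have hR0 : 0 ≤ R := (norm_nonneg _).trans (hζ'R 0 (Metric.mem_closedBall_self hρ.le))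
  obtain ⟨e, μ, hμ, heμ, he⟩ := exists_constant_vector m₁ (show 0 < ρ / 4 by positivity)
  obtain ⟨ε₁, hε₁, hf'⟩ := hf.exists_eventually_norm_parabola_le ζ h R hμ
  obtain ⟨ε₂, hε₂, hg'⟩ := hg.exists_eventually_norm_parabola_le ζ h R (show 0 < ρ / 4 by positivity)
  set ε := min 1 (min ε₁ ε₂) with hε
  have hε0 : 0 < ε := by positivity
  have hε1 : ε ≤ 1 := min_le_left _ _
  have hstate := S.exists_continuousOn_state hu₀ hF hF0 A hA (hVo.mem_nhds hVmem) hreg hmix hk u hu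
    hqF (B := B) hζ'c.continuousOn (fun i => (hac i).continuousOn) hζ'R hh'R
    (fun z hz => (hsol z hz).1) haR (fun z hz => (hsol z hz).2.2.1) hε0
  refine ⟨ρ / 4, by positivity, (‖h‖ + R + 1) + (‖ζ‖ + R + 1), by positivity, ?_⟩
  filter_upwards [hstate, hf' ε ((min_le_right _ _).trans (min_le_left _ _)),
    hg' ε ((min_le_right _ _).trans (min_le_right _ _)), self_mem_nhdsWithin,
    eventually_mul_lt 1 one_pos, eventually_mul_lt R one_pos] with
    δ ⟨x, c, hxc, hx⟩ hf' hg' h0 hδ1 hδR y₁ y₂ hy₁ hy₂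
  have h0 : 0 < δ := h0
  have hδ0 : 0 < δ ^ 2 := by positivity
  obtain ⟨ξ, hξ⟩ : ∃ ξ : EuclideanSpace ℝ (Fin m₁) × EuclideanSpace ℝ (Fin m₂) →
      EuclideanSpace ℝ (Fin n), ∀ z, ξ z = ξ₀ + δ • ζ + δ ^ 2 • ζ' z := ⟨_, fun _ => rfl⟩
  have hξc : Continuous ξ := by
    rw [funext hξ]
    fun_prop
  simp only [← hξ] at hx
  have hfz : ∀ z ∈ B, ∀ i, S.f (ξ z, x z) i ≤ δ ^ 2 * (z.1 i + μ) := by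
    intro z hz
    have h1 := (hf' (ζ' z) (h' z) (x z) (hζ'R z hz) (hh'R z hz)
      (hx z hz).2.2).2
    rw [← hξ] at h1
    refine apply_le_of_norm_sub_le h0 ?_ hf₀ hqf (hsol z hz).2.2.2.1 h1
    have e1 := hsR z hz
    have e2 := (hsol z hz).2.1
    nlinarith
  have hgexp : ∀ z ∈ B, ContinuousAt S.g (ξ z, x z) ∧ ‖S.g (ξ z, x z) - δ ^ 2 • z.2‖ ≤
      ρ / 4 * δ ^ 2 := by
    intro z hz
    have := hg' (ζ' z) (h' z) (x z) (hζ'R z hz) (hh'R z hz) (hx z hz).2.2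
    rwa [(hsol z hz).2.2.2.2, hg₀, hqg, smul_zero, add_zero, zero_add, ← hξ] at this
  have hgc : ContinuousOn (fun z => S.g (ξ z, x z)) B := by
    have hpair : ContinuousOn (fun z => (ξ z, x z)) B := hξc.continuousOn.prodMk hxc
    exact fun z hz => ContinuousAt.comp_continuousWithinAt (g := S.g) (hgexp z hz).1 (hpair z hz)
  obtain ⟨z, hz, hfy, hgy⟩ := exists_le_and_eq_of_norm_sub_le hρ hδ0 heμ he
    (φ := fun z => S.f (ξ z, x z)) hfz hgc (fun z hz => (hgexp z hz).2) hy₁ hy₂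
  obtain ⟨hcm, hFz, hxz⟩ := hx z hz
  refine ⟨ξ z, x z, c z, ⟨hcm, hFz, hfy, hgy⟩, ?_⟩
  have h1 := norm_sub_le_of_parabola h0 (by linarith) hε1 (hh'R z hz) hxz
  have h2 := norm_sub_le_of_parabola (x := ξ z) (x₀ := ξ₀) (h := ζ) h0 (by linarith) zero_le_one
    (hζ'R z hz) (by rw [hξ, sub_self, norm_zero, zero_mul])
  linarith

end ControlSystem
-- Local controllability and the square-root estimate
theorem exists_nhds_mul_sqrt_norm_lt {E₁ E₂ : Type*} [NormedAddCommGroup E₁] [NormedAddCommGroup E₂]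
    (c : ℝ) {δ : ℝ} (hδ : 0 < δ) :
    ∃ W₁ ∈ 𝓝 (0 : E₁), ∃ W₂ ∈ 𝓝 (0 : E₂), ∀ y₁ ∈ W₁, ∀ y₂ ∈ W₂,
      c * √‖WithLp.toLp 2 (y₁, y₂)‖ < δ := by
  have hcont : Continuous fun y : E₁ × E₂ => c * √‖WithLp.toLp 2 y‖ :=
    continuous_const.mul (WithLp.prod_continuous_toLp 2 E₁ E₂).norm.sqrt
  have hev : ∀ᶠ y : E₁ × E₂ in 𝓝 0, c * √‖WithLp.toLp 2 y‖ < δ :=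
    hcont.continuousAt.eventually_lt_const (by simpa using hδ)
  obtain ⟨W₁, hW₁, W₂, hW₂, h⟩ := mem_nhds_prod_iff.mp hev
  exact ⟨W₁, hW₁, W₂, hW₂, fun y₁ hy₁ y₂ hy₂ => h (Set.mk_mem_prod hy₁ hy₂)⟩

theorem theorem1 {n m₁ m₂ : ℕ} {X Y Z : Type*}
    [NormedAddCommGroup X] [NormedSpace ℝ X] [CompleteSpace X]
    [NormedAddCommGroup Y] [NormedSpace ℝ Y] [CompleteSpace Y]
    [NormedAddCommGroup Z] [NormedSpace ℝ Z] [CompleteSpace Z]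
    (S : ControlSystem n m₁ m₂ X Y Z)
    (ξ₀ : EuclideanSpace ℝ (Fin n)) (x₀ : X) (u₀ : Z)
    (hadm : S.IsAdmissible ξ₀ x₀ u₀)
    (hbasic : S.BasicAssumptions ξ₀ x₀ u₀)
    (hq : ∃ q ∈ S.criticalCone ξ₀ x₀ u₀, S.multipliers ξ₀ x₀ u₀ q = ∅) :
    S.IsLocallyControllable ξ₀ x₀ ∧
    ∃ κ₀ : ℝ, 0 < κ₀ ∧ ∀ W ∈ 𝓝 (ξ₀, x₀),
      ∃ W₁ ∈ 𝓝 (0 : EuclideanSpace ℝ (Fin m₁)), ∃ W₂ ∈ 𝓝 (0 : EuclideanSpace ℝ (Fin m₂)),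
        ∀ y₁ ∈ W₁, ∀ y₂ ∈ W₂, ∃ ξ x u, (ξ, x) ∈ W ∧ S.SolvesPerturbed y₁ y₂ ξ x u ∧
          ‖x - x₀‖ + ‖ξ - ξ₀‖ ≤ κ₀ * ‖WithLp.toLp 2 (y₁, y₂)‖ ^ (1 / 2 : ℝ) := by
  obtain ⟨q, hqK, hΛ⟩ := hq
  suffices hmain : ∃ κ₀ : ℝ, 0 < κ₀ ∧ ∀ W ∈ 𝓝 (ξ₀, x₀),
      ∃ W₁ ∈ 𝓝 (0 : EuclideanSpace ℝ (Fin m₁)), ∃ W₂ ∈ 𝓝 (0 : EuclideanSpace ℝ (Fin m₂)),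
        ∀ y₁ ∈ W₁, ∀ y₂ ∈ W₂, ∃ ξ x u, (ξ, x) ∈ W ∧ S.SolvesPerturbed y₁ y₂ ξ x u ∧
          ‖x - x₀‖ + ‖ξ - ξ₀‖ ≤ κ₀ * ‖WithLp.toLp 2 (y₁, y₂)‖ ^ (1 / 2 : ℝ) by
    refine ⟨fun W hW => ?_, hmain⟩
    obtain ⟨κ₀, -, h⟩ := hmain
    obtain ⟨W₁, hW₁, W₂, hW₂, h⟩ := h W hW
    refine ⟨W₁, hW₁, W₂, hW₂, fun y₁ hy₁ y₂ hy₂ => ?_⟩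
    obtain ⟨ξ, x, u, hξx, hsol, -⟩ := h y₁ hy₁ y₂ hy₂
    exact ⟨ξ, x, u, hξx, hsol⟩
  obtain ⟨ρ, hρ, C, hC, hsolve⟩ := S.exists_eventually_solvesPerturbed hadm hbasic hqK hΛ
  -- For `δ = √(|y| / ρ)` the distance bound `C δ` becomes `C ρ^{-1/2} |y|^{1/2}`.
  refine ⟨C * √ρ⁻¹, by positivity, fun W hW => ?_⟩
  obtain ⟨r, hr, hrW⟩ := Metric.mem_nhds_iff.mp hW
  have hsmall : ∀ᶠ δ : ℝ in 𝓝[>] 0, C * δ < r := by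
    simpa only [mul_comm] using eventually_mul_lt C hr
  obtain ⟨δ₀, hδ₀, hδ⟩ := mem_nhdsGT_iff_exists_Ioo_subset.mp (hsolve.and hsmall)
  have hδ₀ : 0 < δ₀ := hδ₀
  obtain ⟨W₁, hW₁, W₂, hW₂, hW₁₂⟩ := exists_nhds_mul_sqrt_norm_lt (E₁ := EuclideanSpace ℝ (Fin m₁))
    (E₂ := EuclideanSpace ℝ (Fin m₂)) (√ρ⁻¹) hδ₀
  refine ⟨W₁, hW₁, W₂, hW₂, fun y₁ hy₁ y₂ hy₂ => ?_⟩
  obtain ⟨N, hN⟩ : ∃ N, N = ‖WithLp.toLp 2 (y₁, y₂)‖ := ⟨_, rfl⟩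
  have hlt : √ρ⁻¹ * √‖WithLp.toLp 2 (y₁, y₂)‖ < δ₀ := hW₁₂ y₁ hy₁ y₂ hy₂
  have hN₁ : ‖y₁‖ ≤ N := hN ▸ WithLp.norm_fst_le _ (WithLp.toLp 2 (y₁, y₂))
  have hN₂ : ‖y₂‖ ≤ N := hN ▸ WithLp.norm_snd_le _ (WithLp.toLp 2 (y₁, y₂))
  rw [← hN, ← Real.sqrt_eq_rpow]
  rw [← hN] at hlt
  -- For `y = 0` the scale `δ` would vanish; the reference point itself is the solution.
  rcases (hN ▸ norm_nonneg _ : 0 ≤ N).eq_or_lt with h0 | hpos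
  · obtain ⟨hu₀, hF0, hf₀, hg₀⟩ := hadm
    have hy₁0 : y₁ = 0 := norm_le_zero_iff.mp (by rwa [← h0] at hN₁)
    have hy₂0 : y₂ = 0 := norm_le_zero_iff.mp (by rwa [← h0] at hN₂)
    subst hy₁0 hy₂0
    exact ⟨ξ₀, x₀, u₀, mem_of_mem_nhds hW, ⟨interior_subset hu₀, hF0, hf₀, hg₀⟩,
      by rw [sub_self, sub_self, norm_zero, norm_zero, add_zero]; positivity⟩
  · have hδpos : 0 < √ρ⁻¹ * √N := by positivity
    have hsq : ρ * (√ρ⁻¹ * √N) ^ 2 = N := by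
      rw [mul_pow, Real.sq_sqrt (by positivity), Real.sq_sqrt hpos.le, mul_inv_cancel_left₀ hρ.ne']
    obtain ⟨hex, hCr⟩ := hδ ⟨hδpos, hlt⟩
    obtain ⟨ξ, x, u, hsol, hdist⟩ := hex y₁ y₂ (by rwa [hsq]) (by rwa [hsq])
    refine ⟨ξ, x, u, hrW ?_, hsol, by rwa [mul_assoc]⟩
    rw [mem_ball_iff_norm, Prod.norm_def]
    refine max_lt ?_ ?_
    · exact lt_of_le_of_lt (by simpa using (le_add_of_nonneg_left (norm_nonneg _)).trans hdist) hCr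
    · exact lt_of_le_of_lt (by simpa using (le_add_of_nonneg_right (norm_nonneg _)).trans hdist) hCr
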